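/- Let $q=p^f$ be a power of a prime $p$, $A=\mathbb F_q[t]$, $K=\mathbb F_q(t)$, and let $v\in A$ be a monic prime of degree $1$, with completion $K_v$ of $K$ at $v$ and normalized additive $v$-adic valuation $\mathrm{ord}_v$ (so $\mathrm{ord}_v(v)=1$, $\mathrm{ord}_v(0)=\infty$). For integers $d\ge 0$ and $k$ put $$\widetilde S_d(k)=\sum_{\substack{a\in A\text{ monic},\ \deg a=d\\ (a,v)=1}}\frac1{a^k}\in K,\qquad \nu_d(k)=\mathrm{ord}_v\big(\widetilde S_d(k)\big),$$ and for $r\ge 1$ and $\mathbf s=(s_1,\dots,s_r)\in\mathbb Z^r$ let $$\zeta_v(\mathbf s)=\sum_{d_1>\cdots>d_r\ge 0}\widetilde S_{d_1}(s_1)\cdots\widetilde S_{d_r}(s_r)\in K_v .$$ For an integer $k\ge 0$ let $l(k)$ be the sum of the base-$q$ digits of $k$ and $L_k=\min_{0\le i<f} l(kp^i)/(q-1)$. An integer $s$ is called $q$-even if $(q-1)\mid s$. A tuple $\mathbf s$ with all $s_i\le 0$ is called a trivial zero if there is $1\le i\le r$ with $r-i>L_{-s_i}+1$. Theorem. Let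 $r\ge1$ and let $\mathbf s=(s_1,\dots,s_r)\in\mathbb Z^r$ with every $s_i\le 0$. Then the series defining $\zeta_v(\mathbf s)$ converges (unconditionally) in $K_v$, and $\zeta_v(\mathbf s)=0$ if and only if one of the following holds: (1) $r>1$ and $\mathbf s$ is a trivial zero; (2) $r=1$ and $s_1$ is $q$-even. Moreover, if $\zeta_v(\mathbf s)\neq 0$, then $$\mathrm{ord}_v\big(\zeta_v(\mathbf s)\big)=\sum_{i=1}^r\nu_{r-i}(s_i)$$ (for $v=t$ this is the $t$-adic valuation), and in particular every $\nu_{r-i}(s_i)$ is finite. -/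

import Mathlib

open Polynomial

noncomputable section

namespace VadicMZV

/-- An integer `s` is `q`-even if `q - 1` divides it. -/
def QEven (q : ℕ) (s : ℤ) : Prop := ((q : ℤ) - 1) ∣ s

/-- For `q = p ^ f`: `L_k = min_{0 ≤ i < f} l(k p^i) / (q - 1)`, where `l` is the sum of the digits
in base `q`. The infimum is over the finite index set `{0, …, f - 1}`, so it is a minimum. -/
def L (p f k : ℕ) : ℝ :=
  ⨅ i : Fin f, (((p ^ f).digits (k * p ^ (i : ℕ))).sum : ℝ) / (((p ^ f : ℕ) : ℝ) - 1)

/-- `s = (s_1, …, s_r)` is a trivial zero of the `v`-adic multiple zeta function (`deg v = 1`,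
`q = p ^ f`) if `r - i > L_{-s_i} + 1` for some `1 ≤ i ≤ r` with `s_i ≤ 0`.
The index `i : Fin r` stands for the index `i + 1` in `{1, …, r}`. -/
def IsTrivialZero (p f : ℕ) {r : ℕ} (s : Fin r → ℤ) : Prop :=
  ∃ i : Fin r, s i ≤ 0 ∧ (r : ℝ) - ((i : ℝ) + 1) > L p f (-s i).toNat + 1

variable (F : Type*) [Field F]

theorem finite_monics [Finite F] (d : ℕ) : {a : F[X] | a.Monic ∧ a.natDegree = d}.Finite := by
  have h : (Set.range fun c : Fin (d + 1) → F =>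
      ∑ i : Fin (d + 1), C (c i) * (X : F[X]) ^ (i : ℕ)).Finite := Set.finite_range _
  refine h.subset ?_
  rintro a ⟨-, rfl⟩
  refine ⟨fun i => a.coeff i, ?_⟩
  have := a.as_sum_range_C_mul_X_pow
  rw [Finset.sum_range] at this
  exact this.symm

/-- `A_{d+}`: the monic polynomials of degree `d` in `A = F[t]`. -/
def monics [Finite F] (d : ℕ) : Finset F[X] := (finite_monics F d).toFinset

variable {F}

open Classical in
/-- The power sum `∑ 1 / a ^ k ∈ K = F(t)` over the monic `a ∈ F[t]` of degree `d` that are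
coprime to `v`. -/
def Stilde [Finite F] (v : F[X]) (d : ℕ) (k : ℤ) : RatFunc F :=
  ∑ a ∈ (monics F d).filter (fun a => IsCoprime a v), 1 / (algebraMap F[X] (RatFunc F) a) ^ k

/-- The place of `F(t)` given by a prime `v` of `F[t]`. -/
def place (v : F[X]) (hv : Irreducible v) : IsDedekindDomain.HeightOneSpectrum F[X] where
  asIdeal := Ideal.span {v}
  isPrime := (Ideal.span_singleton_prime hv.ne_zero).mpr hv.prime
  ne_bot := by
    rw [Ne, Ideal.span_singleton_eq_bot]
    exact hv.ne_zero

/-- `K_v`: the completion of `K = F(t)` at `v`. -/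
abbrev Kv (v : F[X]) (hv : Irreducible v) : Type _ :=
  (place v hv).adicCompletion (RatFunc F)

open Classical in
/-- The normalized additive `v`-adic valuation on `K_v`, with value `⊤` at `0`. -/
def ord (v : F[X]) (hv : Irreducible v) (x : Kv v hv) : WithTop ℤ :=
  if x = 0 then ⊤ else ((-WithZero.log (Valued.v x) : ℤ) : WithTop ℤ)

/-- `ν_d(k)`: the `v`-adic valuation of the power sum of degree `d` prime to `v`. -/
def nu [Finite F] (v : F[X]) (hv : Irreducible v) (d : ℕ) (k : ℤ) : WithTop ℤ :=
  ord v hv (algebraMap (RatFunc F) (Kv v hv) (Stilde v d k))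

/-- The summand, for `d_1 > ⋯ > d_r ≥ 0`, of the `v`-adic multiple zeta value. -/
def zetaTerm [Finite F] (v : F[X]) (hv : Irreducible v) {r : ℕ} (s : Fin r → ℤ)
    (d : {d : Fin r → ℕ // StrictAnti d}) : Kv v hv :=
  algebraMap (RatFunc F) (Kv v hv) (∏ i, Stilde v (d.1 i) (s i))

/-- The `v`-adic multiple zeta value `ζ_v(s_1, …, s_r) ∈ K_v`. -/
def zeta [Finite F] (v : F[X]) (hv : Irreducible v) {r : ℕ} (s : Fin r → ℤ) : Kv v hv :=
  ∑' d : {d : Fin r → ℕ // StrictAnti d}, zetaTerm v hv s d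

end VadicMZV

end

/-!
# Zeros and valuations of `v`-adic multiple zeta values at nonpositive integers

Translating `t` reduces the prime `v = t - θ` to `t` itself, and orders at `v` become trailing
degrees of the polynomials `powerSumPrime d k = ∑ a ^ k` (`a` monic of degree `d` with `a(0) ≠ 0`).
Writing `a = X b + c` and summing over `c` expresses these power sums by those of smaller degree
(`powerSum_succ`, `powerSumPrime_succ`). Unfolding the recursion, and using Lucas' theorem to decide
which binomial coefficients survive, `powerSumPrime d k` is a sum of monomials
`± ∏ binomials * X ^ (m_1 + ⋯ + m_d)` indexed by the chains `k ≥ m_1 > ⋯ > m_d` that are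
decreasing in the digitwise order in base `p` and congruent to `k` modulo `q - 1` (`NumChain`).

The heart of the matter is that **the chain with the least sum is unique** (`IsMinChain.unique`), so
that its monomial cannot cancel: the trailing degree of `powerSumPrime d k` is that least sum, and
the polynomial vanishes if and only if there is no chain. Dropping `m_1` shows that the trailing
degree increases with `d`, strictly so from `d = 1` on. Since `d_i ≥ r - i` for every index
`d_1 > ⋯ > d_r ≥ 0` of the series, for `r > 1` the term with `d_i = r - i` for all `i` strictly
dominates (`valued_zeta`), unless it contains a vanishing power sum, in which case all terms
vanish. By `le_L_iff` the latter happens exactly for trivial zeros. For `r = 1` the same argument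
works when `s_1` is not `q`-even; when it is, the power sums add up to `0` by the recursion
(`sum_powerSumPrime_eq_zero`).

Uniqueness follows by induction on the length once the first number of a cheapest chain is known to
be as small as in any chain of that length (`NumChain.exists_sum_lt`). To prove this, the base-`p`
digits of a number are cut into tokens: a digit `b` at position `l` gives `b` tokens of type
`l mod f` and value `p ^ l`. The congruence modulo `q - 1` says that the numbers of tokens of each
type, `c_t`, can be written `c_t = ρ_t + p y_t - y_{t-1}` with an integer vector `y` on `ℤ/f` and a
fixed vector `ρ`, and chains of numbers become chains of vectors decreasing at every place. Three
facts about such vectors are used. The value of the cheapest tokens encoded by `y` is submodular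
(`TokenSystem.inf_sup`). Chains of vectors may be made nested on the level of tokens at no cost
(`Chain.exists_nested`), whence they come from chains of numbers. Finally, if the first vector of
a chain is not the cheapest vector `u` that leaves room for a chain below it, replacing it by `u`
and pushing the others down makes the chain cheaper (`Chain.exists_cheaper`): by an exchange
argument (`exists_exchange`) the replacement gains at least `p ^ (e - f + 1)`, where `e` is the
highest level involved, while the `i`-th of the other vectors acquires only new tokens of level
below `e - i f`, which together cost less. All the auxiliary vectors arise as solutions of cyclic
systems of inequalities `p h_t - h_{t-1} ≤ r_t` that are as small as possible
(`exists_least_solution`).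
-/

namespace VadicMZV

/-! ### Least solutions of cyclic systems of inequalities -/

/-- The operator `y ↦ (p y_t - y_{t-1})_t` on integer vectors indexed by `ℤ/f`. -/
def carry (p : ℕ) {f : ℕ} (y : ZMod f → ℤ) (t : ZMod f) : ℤ := p * y t - y (t - 1)

theorem carry_add (p : ℕ) {f : ℕ} (x y : ZMod f → ℤ) (t : ZMod f) :
    carry p (x + y) t = carry p x t + carry p y t := by
  simp only [carry, Pi.add_apply]; ring

theorem carry_sub (p : ℕ) {f : ℕ} (x y : ZMod f → ℤ) (t : ZMod f) :
    carry p (x - y) t = carry p x t - carry p y t := by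
  simp only [carry, Pi.sub_apply]; ring

/-- A vector between `s` and `W` satisfying `carry p h ≤ r` with smallest coordinate sum: each
coordinate is pinned either by the seed `s` or by the inequality it has to satisfy. -/
theorem exists_least_solution {p f : ℕ} [NeZero f] (s W r : ZMod f → ℤ) (hsW : s ≤ W)
    (hW : ∀ t, carry p W t ≤ r t) :
    ∃ h, s ≤ h ∧ h ≤ W ∧ (∀ t, carry p h t ≤ r t) ∧
      ∀ t, h (t - 1) = s (t - 1) ∨ carry p h t = r t := by
  classical
  let A : Finset (ZMod f → ℤ) := (Finset.Icc s W).filter fun h => ∀ t, carry p h t ≤ r t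
  have hA : A.Nonempty := ⟨W, by simp [A, hsW, hW]⟩
  obtain ⟨h, hh, hmin⟩ := A.exists_min_image (fun h => ∑ t, h t) hA
  simp only [A, Finset.mem_filter, Finset.mem_Icc] at hh hmin
  obtain ⟨⟨h1, h2⟩, h3⟩ := hh
  refine ⟨h, h1, h2, h3, fun t => ?_⟩
  by_contra! hcon
  obtain ⟨hc1, hc2⟩ := hcon
  set h' := Function.update h (t - 1) (h (t - 1) - 1) with hh'
  have hle : h' ≤ h := by
    intro u
    by_cases hu : u = t - 1
    · subst hu; simp [hh']
    · simp [hh', hu]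
  have hs' : s ≤ h' := by
    intro u
    by_cases hu : u = t - 1
    · subst hu
      have := h1 (t - 1)
      have := lt_of_le_of_ne this (Ne.symm hc1)
      simp [hh']; omega
    · simpa [hh', hu] using h1 u
  have hc' : ∀ u, carry p h' u ≤ r u := by
    intro u
    have ha : (p : ℤ) * h' u ≤ p * h u := mul_le_mul_of_nonneg_left (hle u) (by positivity)
    have hb := h3 u
    by_cases hu : u = t
    · subst hu
      have := lt_of_le_of_ne hb hc2
      have hx : h' (u - 1) = h (u - 1) - 1 := by simp [hh']
      simp only [carry] at *
      rw [hx]; omega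
    · have hx : h' (u - 1) = h (u - 1) := by
        have : u - 1 ≠ t - 1 := fun e => hu (sub_left_injective e)
        simp [hh', this]
      simp only [carry] at *
      rw [hx]; omega
  have hlt := hmin h' ⟨⟨hs', hle.trans h2⟩, hc'⟩
  have : ∑ u, h' u < ∑ u, h u :=
    Finset.sum_lt_sum (fun u _ => hle u) ⟨t - 1, Finset.mem_univ _, by simp [hh']⟩
  omega

/-- The vector `y` recovered, up to the factor `p ^ f - 1`, from `carry p y`. -/
def uncarry (p : ℕ) {f : ℕ} (c : ZMod f → ℤ) (t : ZMod f) : ℤ :=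
  ∑ i ∈ Finset.range f, (p : ℤ) ^ i * c (t + 1 + i)

theorem uncarry_pred (p : ℕ) {f : ℕ} [NeZero f] (c : ZMod f → ℤ) (t : ZMod f) :
    uncarry p c (t - 1) = p * uncarry p c t - ((p : ℤ) ^ f - 1) * c t := by
  obtain ⟨g, rfl⟩ : ∃ g, f = g + 1 := ⟨f - 1, by have := NeZero.pos f; omega⟩
  unfold uncarry
  rw [Finset.sum_range_succ', Finset.sum_range_succ]
  have h1 : (t + 1 + (g : ZMod (g + 1))) = t := by
    have : ((g + 1 : ℕ) : ZMod (g + 1)) = 0 := ZMod.natCast_self _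
    push_cast at this
    rw [add_assoc, add_comm 1, this, add_zero]
  have h2 : ∀ i : ℕ, t + ((i + 1 : ℕ) : ZMod (g + 1)) = t + 1 + i := by
    intro i; push_cast; ring
  simp only [sub_add_cancel, h1, h2, pow_zero, one_mul, Nat.cast_zero, add_zero]
  rw [mul_add, Finset.mul_sum]
  have : ∀ i ∈ Finset.range g, (p : ℤ) ^ (i + 1) * c (t + 1 + i)
      = p * (p ^ i * c (t + 1 + i)) := by intro i _; ring
  rw [Finset.sum_congr rfl this]
  ring

theorem uncarry_carry (p : ℕ) {f : ℕ} [NeZero f] (y : ZMod f → ℤ) (t : ZMod f) :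
    uncarry p (carry p y) t = ((p : ℤ) ^ f - 1) * y t := by
  have h : ∀ n : ℕ, ∑ i ∈ Finset.range n, (p : ℤ) ^ i * carry p y (t + 1 + i)
      = (p : ℤ) ^ n * y (t + n) - y t := by
    intro n
    induction n with
    | zero => simp
    | succ n ih =>
      rw [Finset.sum_range_succ, ih]
      have h1 : t + 1 + (n : ZMod f) - 1 = t + n := by ring
      have h2 : t + 1 + (n : ZMod f) = t + (n + 1 : ℕ) := by push_cast; ring
      rw [carry, h1, h2]
      ring
  unfold uncarry
  rw [h]
  simp; ring

theorem carry_injective {p f : ℕ} [NeZero f] (hp : 2 ≤ p) {x y : ZMod f → ℤ}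
    (h : ∀ t, carry p x t = carry p y t) : x = y := by
  funext t
  have hx := uncarry_carry p x t
  have hy := uncarry_carry p y t
  rw [funext h, hy] at hx
  have : (0 : ℤ) < (p : ℤ) ^ f - 1 := by
    have : (1 : ℤ) < (p : ℤ) ^ f := one_lt_pow₀ (by exact_mod_cast hp) (NeZero.ne f)
    omega
  exact (mul_left_cancel₀ this.ne' hx).symm

theorem add_one_add_natCast_ne {f : ℕ} {t : ZMod f} {i : ℕ} (hi : i < f - 1) :
    t + 1 + (i : ZMod f) ≠ t := by
  intro h
  have : ((i + 1 : ℕ) : ZMod f) = 0 := by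
    have : t + (1 + (i : ZMod f)) = t + 0 := by rw [← add_assoc, h, add_zero]
    push_cast
    rw [add_comm]
    exact add_left_cancel this
  rw [ZMod.natCast_eq_zero_iff] at this
  have := Nat.le_of_dvd (by omega) this
  omega

/-- If the vector `ℓ ≥ 0` is heavy enough away from `t₀`, one unit at `t₀` can be traded against
at most `ℓ` units elsewhere. -/
theorem exists_exchange {p f : ℕ} [NeZero f] (hp : 2 ≤ p) (ℓ : ZMod f → ℤ) (t₀ : ZMod f)
    (hℓ : ∀ t, 0 ≤ ℓ t)
    (hbig : (p : ℤ) ^ (f - 1) ≤ ∑ i ∈ Finset.range (f - 1), (p : ℤ) ^ i * ℓ (t₀ + 1 + i)) :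
    ∃ h : ZMod f → ℤ, 0 ≤ h ∧ carry p h t₀ = -1 ∧
      ∀ t, t ≠ t₀ → 0 ≤ carry p h t ∧ carry p h t ≤ ℓ t := by
  classical
  -- `h` is the least solution of `carry h ≤ ℓ'`, where `ℓ'` prescribes a surplus `-1` at `t₀`;
  -- `uncarry ℓ' / (p ^ f - 1)`, rounded down, is a solution and it is nonnegative
  set ℓ' := Function.update ℓ t₀ (-1) with hℓ'
  have hℓ0 : ℓ' t₀ = -1 := by simp [hℓ']
  have hℓ1 : ∀ t, t ≠ t₀ → ℓ' t = ℓ t := fun t ht => by simp [hℓ', ht]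
  have hq : (0 : ℤ) < (p : ℤ) ^ f - 1 := by
    have : (1 : ℤ) < (p : ℤ) ^ f := one_lt_pow₀ (by exact_mod_cast hp) (NeZero.ne f)
    omega
  have hN0 : 0 ≤ uncarry p ℓ' t₀ := by
    obtain ⟨g, hg⟩ : ∃ g, f = g + 1 := ⟨f - 1, by have := NeZero.pos f; omega⟩
    have hsum : uncarry p ℓ' t₀ =
        ∑ i ∈ Finset.range (f - 1), (p : ℤ) ^ i * ℓ (t₀ + 1 + i) - (p : ℤ) ^ (f - 1) := by
      have hf : f = (f - 1) + 1 := by omega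
      have hlast : t₀ + 1 + ((f - 1 : ℕ) : ZMod f) = t₀ := by
        have : ((f - 1 + 1 : ℕ) : ZMod f) = 0 := by rw [← hf]; exact ZMod.natCast_self _
        rw [Nat.cast_add, Nat.cast_one] at this
        rw [add_assoc, add_comm 1, this, add_zero]
      unfold uncarry
      have : ∀ F : ℕ → ℤ, ∑ i ∈ Finset.range f, F i
          = ∑ i ∈ Finset.range (f - 1), F i + F (f - 1) := by
        intro F; conv_lhs => rw [hf]
        exact Finset.sum_range_succ _ _
      rw [this, hlast, hℓ0]
      have : ∀ i ∈ Finset.range (f - 1), (p : ℤ) ^ i * ℓ' (t₀ + 1 + i)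
          = (p : ℤ) ^ i * ℓ (t₀ + 1 + i) := by
        intro i hi
        rw [hℓ1 _ (add_one_add_natCast_ne (Finset.mem_range.mp hi))]
      rw [Finset.sum_congr rfl this]; ring
    omega
  have hpp : (0 : ℤ) < p := by positivity
  have hNn : ∀ j : ℕ, 0 ≤ uncarry p ℓ' (t₀ + j) := by
    intro j
    induction j with
    | zero => simpa using hN0
    | succ j ih =>
      by_cases hj : t₀ + ((j + 1 : ℕ) : ZMod f) = t₀
      · rw [hj]; exact hN0
      · have h := uncarry_pred p ℓ' (t₀ + ((j + 1 : ℕ) : ZMod f))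
        have he : t₀ + ((j + 1 : ℕ) : ZMod f) - 1 = t₀ + j := by push_cast; ring
        rw [he, hℓ1 _ hj] at h
        have h1 : 0 ≤ ((p : ℤ) ^ f - 1) * ℓ (t₀ + ((j + 1 : ℕ) : ZMod f)) :=
          mul_nonneg hq.le (hℓ _)
        have : 0 ≤ (p : ℤ) * uncarry p ℓ' (t₀ + ((j + 1 : ℕ) : ZMod f)) := by linarith
        exact nonneg_of_mul_nonneg_right this hpp
  have hN : ∀ t, 0 ≤ uncarry p ℓ' t := by
    intro t
    have := hNn (t - t₀).val
    rwa [ZMod.natCast_zmod_val, add_sub_cancel] at this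
  obtain ⟨h, h1, -, h3, h4⟩ := exists_least_solution (p := p) 0
    (fun t => uncarry p ℓ' t / ((p : ℤ) ^ f - 1)) ℓ'
    (fun t => Int.ediv_nonneg (hN t) hq.le) (by
      intro t
      simp only [carry]
      have h := uncarry_pred p ℓ' t
      have hd := Int.ediv_mul_le (uncarry p ℓ' t) hq.ne'
      have : p * (uncarry p ℓ' t / ((p : ℤ) ^ f - 1)) - ℓ' t
          ≤ uncarry p ℓ' (t - 1) / ((p : ℤ) ^ f - 1) := by
        rw [Int.le_ediv_iff_mul_le hq, h]
        have := mul_le_mul_of_nonneg_left hd hpp.le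
        linarith
      omega)
  have hnn : ∀ t, h (t - 1) = 0 → 0 ≤ carry p h t := by
    intro t ht
    simp only [carry, ht, sub_zero]
    exact mul_nonneg hpp.le (h1 t)
  refine ⟨h, h1, ?_, fun t ht => ?_⟩
  · have := h3 t₀
    rcases h4 t₀ with h5 | h5
    · have := hnn _ h5
      omega
    · rw [h5, hℓ0]
  · have := h3 t
    rw [hℓ1 t ht] at this
    refine ⟨?_, this⟩
    rcases h4 t with h5 | h5
    · exact hnn _ h5
    · rw [h5, hℓ1 t ht]; exact hℓ t


/-! ### Token systems -/

/-- For each type `t ∈ ℤ/f`, a list of `n t` tokens ordered by level, where the level of a token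
is congruent to its type and at most `p - 1` tokens share a level. A token of level `l` is worth
`p ^ l`. The model is a natural number, its base-`p` digit at position `l` being cut into tokens
of level `l`; the `offset` records the class modulo `p ^ f - 1` of the numbers considered. -/
structure TokenSystem (p f : ℕ) where
  n : ZMod f → ℕ
  lev : ZMod f → ℕ → ℕ
  offset : ZMod f → ℤ
  offset_nonneg : ∀ t, 0 ≤ offset t
  lev_mono : ∀ t r r', r ≤ r' → r' < n t → lev t r ≤ lev t r'
  lev_cast : ∀ t r, r < n t → (lev t r : ZMod f) = t
  lev_gap : ∀ t r, r + (p - 1) < n t → lev t r < lev t (r + (p - 1))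

namespace TokenSystem

variable {p f : ℕ} (T : TokenSystem p f)

theorem card_level_le (S : Finset (Σ _ : ZMod f, ℕ)) (hS : ∀ x ∈ S, x.2 < T.n x.1)
    (l : ℕ) : (S.filter fun x => T.lev x.1 x.2 = l).card ≤ p - 1 := by
  classical
  rcases (S.filter fun x => T.lev x.1 x.2 = l).eq_empty_or_nonempty with h0 | h0
  · simp [h0]
  obtain ⟨x, hx, hmin⟩ := Finset.exists_min_image _ (fun x => x.2) h0
  have hsub : (S.filter fun x => T.lev x.1 x.2 = l) ⊆
      (Finset.Ico x.2 (x.2 + (p - 1))).image (fun r => ⟨x.1, r⟩) := by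
    intro z hz
    have hz1 := hmin z hz
    simp only [Finset.mem_filter] at hx hz
    have ht : z.1 = x.1 := by
      rw [← T.lev_cast z.1 z.2 (hS _ hz.1), ← T.lev_cast x.1 x.2 (hS _ hx.1), hz.2, hx.2]
    simp only [Finset.mem_image, Finset.mem_Ico]
    refine ⟨z.2, ⟨hz1, ?_⟩, ?_⟩
    · by_contra! hcon
      have h1 := hS _ hz.1
      have h2 := T.lev_mono z.1 _ _ hcon h1
      have h3 := T.lev_gap z.1 x.2 (by omega)
      rw [ht] at h2 h3
      rw [hx.2] at h3
      have h4 := hz.2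
      rw [ht] at h4
      omega
    · rw [← ht]
  calc _ ≤ _ := Finset.card_le_card hsub
    _ ≤ _ := Finset.card_image_le
    _ = p - 1 := by simp

/-- Tokens of level less than `M` are worth less than `p ^ M` in total. -/
theorem sum_lt_pow (hp : 2 ≤ p) (S : Finset (Σ _ : ZMod f, ℕ)) (hS : ∀ x ∈ S, x.2 < T.n x.1)
    (M : ℕ) (hM : ∀ x ∈ S, T.lev x.1 x.2 < M) : ∑ x ∈ S, p ^ T.lev x.1 x.2 < p ^ M := by
  have h1 : ∑ x ∈ S, p ^ T.lev x.1 x.2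
      = ∑ l ∈ Finset.range M, ∑ x ∈ S with T.lev x.1 x.2 = l, p ^ T.lev x.1 x.2 :=
    (Finset.sum_fiberwise_of_maps_to (fun x hx => Finset.mem_range.mpr (hM x hx)) _).symm
  have h2 : ∀ l ∈ Finset.range M, ∑ x ∈ S with T.lev x.1 x.2 = l, p ^ T.lev x.1 x.2
      ≤ (p - 1) * p ^ l := by
    intro l _
    rw [Finset.sum_congr rfl (g := fun _ => p ^ l)
      (fun x hx => by rw [(Finset.mem_filter.mp hx).2])]
    rw [Finset.sum_const, smul_eq_mul]
    exact Nat.mul_le_mul_right _ (T.card_level_le S hS l)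
  have h3 : ∑ l ∈ Finset.range M, (p - 1) * p ^ l + 1 = p ^ M := by
    rw [← Finset.mul_sum, mul_comm]
    have := Nat.geomSum_eq (m := p) hp M
    have h4 : (∑ l ∈ Finset.range M, p ^ l) * (p - 1) = p ^ M - 1 := by
      zify [Nat.one_le_two_pow.trans (Nat.pow_le_pow_left hp M), (by omega : 1 ≤ p)]
      exact geom_sum_mul (p : ℤ) M
    rw [h4]
    have : 0 < p ^ M := by positivity
    omega
  have := Finset.sum_le_sum h2
  omega

/-- Tokens `i * (p - 1)` places apart are at least `i * f` levels apart. -/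
theorem lev_add_le {t : ZMod f} {r : ℕ} (i : ℕ) (h : r + i * (p - 1) < T.n t) :
    T.lev t r + i * f ≤ T.lev t (r + i * (p - 1)) := by
  induction i with
  | zero => simp
  | succ i ih =>
    have e : r + (i + 1) * (p - 1) = r + i * (p - 1) + (p - 1) := by ring
    rw [e] at h ⊢
    have h1 := ih (by omega)
    have h2 := T.lev_gap t _ h
    have h3 := T.lev_cast t _ h
    replace h3 := h3.trans (T.lev_cast t (r + i * (p - 1)) (by omega)).symm
    rw [ZMod.natCast_eq_natCast_iff] at h3
    obtain ⟨m, hm⟩ := (Nat.modEq_iff_dvd' h2.le).mp h3.symm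
    have hm0 : 1 ≤ m := by
      rcases m with _ | m
      · omega
      · omega
    have : f ≤ f * m := Nat.le_mul_of_pos_right f hm0
    rw [add_mul, one_mul]
    omega

/-- The numbers of tokens encoded by the vector `y`. -/
def cnt (y : ZMod f → ℤ) (t : ZMod f) : ℤ := T.offset t + carry p y t

/-- The vector `y` encodes numbers of tokens that do not exceed the supply. -/
def Feasible (y : ZMod f → ℤ) : Prop := ∀ t, 0 ≤ T.cnt y t ∧ T.cnt y t ≤ T.n t

theorem cnt_add (x y : ZMod f → ℤ) (t : ZMod f) : T.cnt (x + y) t = T.cnt x t + carry p y t := by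
  simp only [cnt, carry_add]; ring

theorem cnt_sub (x y : ZMod f → ℤ) (t : ZMod f) : T.cnt (x - y) t = T.cnt x t - carry p y t := by
  simp only [cnt, carry_sub]; ring

variable [NeZero f]

/-- The total value of the `c t` lowest tokens of every type `t`. -/
def val (c : ZMod f → ℤ) : ℕ := ∑ t, ∑ r ∈ Finset.range (c t).toNat, p ^ T.lev t r

/-- The total value of the tokens counted by `c'` but not by `c`. -/
def gain (c c' : ZMod f → ℤ) : ℕ :=
  ∑ t, ∑ r ∈ Finset.Ico (c t).toNat (c' t).toNat, p ^ T.lev t r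

theorem val_add_gain (c c' : ZMod f → ℤ) : T.val c + T.gain c c' = T.val c' + T.gain c' c := by
  unfold val gain
  rw [← Finset.sum_add_distrib, ← Finset.sum_add_distrib]
  refine Finset.sum_congr rfl fun t _ => ?_
  rcases le_total (c t).toNat (c' t).toNat with h | h
  · rw [Finset.Ico_eq_empty_of_le h, Finset.sum_empty, add_zero, Finset.range_eq_Ico,
      Finset.range_eq_Ico, Finset.sum_Ico_consecutive _ (Nat.zero_le _) h]
  · rw [Finset.Ico_eq_empty_of_le h, Finset.sum_empty, add_zero, Finset.range_eq_Ico,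
      Finset.range_eq_Ico, Finset.sum_Ico_consecutive _ (Nat.zero_le _) h]

theorem gain_eq_sum (c c' : ZMod f → ℤ) : T.gain c c' =
    ∑ x ∈ Finset.univ.sigma fun t => Finset.Ico (c t).toNat (c' t).toNat, p ^ T.lev x.1 x.2 := by
  rw [Finset.sum_sigma]; rfl

theorem gain_lt_pow (hp : 2 ≤ p) {c c' : ZMod f → ℤ} (hc' : ∀ t, c' t ≤ T.n t) (M : ℕ)
    (hM : ∀ t r, (c t).toNat ≤ r → r < (c' t).toNat → T.lev t r < M) :
    T.gain c c' < p ^ M := by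
  rw [gain_eq_sum]
  refine T.sum_lt_pow hp _ ?_ M ?_
  · rintro ⟨t, r⟩ hx
    simp only [Finset.mem_sigma, Finset.mem_Ico] at hx
    have := hc' t
    have := hx.2.2
    simp only; omega
  · rintro ⟨t, r⟩ hx
    simp only [Finset.mem_sigma, Finset.mem_Ico] at hx
    exact hM t r hx.2.1 hx.2.2

theorem pow_le_gain {c c' : ZMod f → ℤ} (t : ZMod f) (r : ℕ) (h1 : (c t).toNat ≤ r)
    (h2 : r < (c' t).toNat) : p ^ T.lev t r ≤ T.gain c c' := by
  rw [gain_eq_sum]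
  exact Finset.single_le_sum (f := fun x : (Σ _ : ZMod f, ℕ) => p ^ T.lev x.1 x.2)
    (fun _ _ => Nat.zero_le _)
    (a := ⟨t, r⟩) (by simp [h1, h2])

/-- If `b` is worth at least as much as `a ≠ b`, then among the tokens counted by just one of `a`
and `b` those of the highest level are counted by `b`. -/
theorem exists_top (hp : 2 ≤ p) {a b : ZMod f → ℤ} (ha : ∀ t, 0 ≤ a t ∧ a t ≤ T.n t)
    (hb : ∀ t, 0 ≤ b t ∧ b t ≤ T.n t) (hab : a ≠ b) (hle : T.val a ≤ T.val b) :
    ∃ s e, a s < b s ∧ T.lev s (b s - 1).toNat = e ∧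
      (∀ t r, (a t).toNat ≤ r → r < (b t).toNat → T.lev t r ≤ e) ∧
      (∀ t r, (b t).toNat ≤ r → r < (a t).toNat → T.lev t r < e) := by
  classical
  let D : Finset (Σ _ : ZMod f, ℕ) :=
    (Finset.univ.sigma fun t => Finset.Ico (a t).toNat (b t).toNat) ∪
      (Finset.univ.sigma fun t => Finset.Ico (b t).toNat (a t).toNat)
  have hD : D.Nonempty := by
    obtain ⟨t, ht⟩ := Function.ne_iff.mp hab
    have := ha t
    have := hb t
    rcases lt_or_gt_of_ne ht with h | h
    · exact ⟨⟨t, (a t).toNat⟩, by simp [D]; omega⟩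
    · exact ⟨⟨t, (b t).toNat⟩, by simp [D]; omega⟩
  obtain ⟨⟨s, r₀⟩, hx, hmax⟩ := D.exists_max_image (fun x => T.lev x.1 x.2) hD
  simp only [D, Finset.mem_union, Finset.mem_sigma, Finset.mem_univ, true_and, Finset.mem_Ico]
    at hx hmax
  have has := ha s
  have hbs := hb s
  have hadd : (∀ t r, (a t).toNat ≤ r → r < (b t).toNat → T.lev t r ≤ T.lev s r₀) :=
    fun t r h1 h2 => hmax ⟨t, r⟩ (Or.inl ⟨h1, h2⟩)
  have hrem : (∀ t r, (b t).toNat ≤ r → r < (a t).toNat → T.lev t r ≤ T.lev s r₀) :=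
    fun t r h1 h2 => hmax ⟨t, r⟩ (Or.inr ⟨h1, h2⟩)
  have hcs : (T.lev s r₀ : ZMod f) = s := T.lev_cast s r₀ (by omega)
  rcases hx with hx | hx
  · refine ⟨s, _, by omega, le_antisymm (hadd s _ (by omega) (by omega))
      (T.lev_mono s _ _ (by omega) (by omega)), hadd, fun t r h1 h2 => ?_⟩
    refine lt_of_le_of_ne (hrem t r h1 h2) fun heq => ?_
    have : t = s := by
      rw [← T.lev_cast t r (by have := ha t; omega), heq, hcs]
    subst this
    omega
  · exfalso
    have h1 : T.gain a b < p ^ T.lev s r₀ := by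
      refine T.gain_lt_pow hp (fun t => (hb t).2) _ fun t r h1 h2 => ?_
      refine lt_of_le_of_ne (hadd t r h1 h2) fun heq => ?_
      have : t = s := by
        rw [← T.lev_cast t r (by have := hb t; omega), heq, hcs]
      subst this
      omega
    have h2 := T.pow_le_gain (c := b) (c' := a) s r₀ hx.1 hx.2
    have h3 := T.val_add_gain a b
    omega

/-- Convexity of the value of the `c` lowest tokens of a type as a function of `c`. -/
theorem val_add_val_le (hp : 1 ≤ p) {a b c c' : ZMod f → ℤ}
    (ha : ∀ t, 0 ≤ a t ∧ a t ≤ T.n t) (hb : ∀ t, 0 ≤ b t ∧ b t ≤ T.n t)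
    (hsum : ∀ t, c t + c' t = a t + b t)
    (hbetween : ∀ t, min (a t) (b t) ≤ c t ∧ c t ≤ max (a t) (b t)) :
    T.val c + T.val c' ≤ T.val a + T.val b := by
  have key : ∀ (t : ZMod f) (x y z w : ℕ), x ≤ z → z ≤ y → z + w = x + y → y ≤ T.n t →
      ∑ r ∈ Finset.range z, p ^ T.lev t r + ∑ r ∈ Finset.range w, p ^ T.lev t r ≤
      ∑ r ∈ Finset.range x, p ^ T.lev t r + ∑ r ∈ Finset.range y, p ^ T.lev t r := by
    intro t x y z w h1 h2 h3 h4
    have e1 := Finset.sum_range_add (fun r => p ^ T.lev t r) x (z - x)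
    have e2 := Finset.sum_range_add (fun r => p ^ T.lev t r) w (z - x)
    rw [show x + (z - x) = z by omega] at e1
    rw [show w + (z - x) = y by omega] at e2
    rw [e1, e2]
    have : ∑ r ∈ Finset.range (z - x), p ^ T.lev t (x + r)
        ≤ ∑ r ∈ Finset.range (z - x), p ^ T.lev t (w + r) := by
      refine Finset.sum_le_sum fun r hr => ?_
      have := Finset.mem_range.mp hr
      exact Nat.pow_le_pow_right hp (T.lev_mono t _ _ (by omega) (by omega))
    omega
  unfold val
  rw [← Finset.sum_add_distrib, ← Finset.sum_add_distrib]
  refine Finset.sum_le_sum fun t _ => ?_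
  have h1 := ha t
  have h2 := hb t
  have h3 := hsum t
  have h4 := hbetween t
  rcases le_total (a t) (b t) with h | h
  · rw [min_eq_left h, max_eq_right h] at h4
    exact key t _ _ _ _ (by omega) (by omega) (by omega) (by omega)
  · rw [min_eq_right h, max_eq_left h] at h4
    rw [add_comm (∑ r ∈ Finset.range (a t).toNat, _)]
    exact key t _ _ _ _ (by omega) (by omega) (by omega) (by omega)

/-- The value of the tokens encoded by `y`. -/
def cost (y : ZMod f → ℤ) : ℕ := T.val (T.cnt y)

theorem cnt_injective (hp : 2 ≤ p) {x y : ZMod f → ℤ} (h : T.cnt x = T.cnt y) : x = y := by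
  refine carry_injective hp fun t => ?_
  have := congrFun h t
  simp only [cnt] at this
  omega

/-- Feasible vectors form a lattice, on which the cost is submodular. -/
theorem inf_sup (hp : 2 ≤ p) {x y : ZMod f → ℤ} (hx : T.Feasible x) (hy : T.Feasible y) :
    T.Feasible (x ⊓ y) ∧ T.Feasible (x ⊔ y) ∧
      T.cost (x ⊓ y) + T.cost (x ⊔ y) ≤ T.cost x + T.cost y := by
  have hsum : ∀ t, T.cnt (x ⊓ y) t + T.cnt (x ⊔ y) t = T.cnt x t + T.cnt y t := by
    intro t
    have h1 := min_add_max (x t) (y t)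
    have h2 := min_add_max (x (t - 1)) (y (t - 1))
    simp only [cnt, carry, Pi.inf_apply, Pi.sup_apply]
    linear_combination (p : ℤ) * h1 - h2
  have hpp : (0 : ℤ) ≤ p := by positivity
  have hb : ∀ t, min (T.cnt x t) (T.cnt y t) ≤ T.cnt (x ⊓ y) t ∧
      T.cnt (x ⊓ y) t ≤ max (T.cnt x t) (T.cnt y t) := by
    intro t
    simp only [cnt, carry, Pi.inf_apply]
    rcases le_total (x t) (y t) with h | h <;>
      have h' := mul_le_mul_of_nonneg_left h hpp
    · rw [min_eq_left h]; omega
    · rw [min_eq_right h]; omega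
  have hF : T.Feasible (x ⊓ y) := by
    intro t
    have := hb t; have := hx t; have := hy t
    omega
  have hF' : T.Feasible (x ⊔ y) := by
    intro t
    have := hb t; have := hx t; have := hy t; have := hsum t
    omega
  exact ⟨hF, hF', T.val_add_val_le (by omega) hx hy hsum hb⟩

/-- Below a feasible vector that exceeds `N` everywhere there is another one, smaller at every
place, still at least `N`, and using no more tokens of any type. -/
theorem exists_feasible_lt {x : ZMod f → ℤ} (hp : 1 ≤ p) (hx : T.Feasible x) {N : ℤ} (hN : 0 ≤ N)
    (hxN : ∀ t, N + 1 ≤ x t) :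
    ∃ z, T.Feasible z ∧ (∀ t, z t + 1 ≤ x t) ∧ (∀ t, N ≤ z t) ∧ ∀ t, T.cnt z t ≤ T.cnt x t := by
  obtain ⟨h, h1, h2, h3, h4⟩ := exists_least_solution (p := p) (fun _ => 1) (fun t => x t - N)
    (T.cnt x) (fun t => by have := hxN t; simp only; omega) (by
      intro t
      have := T.offset_nonneg t
      have : N ≤ p * N := le_mul_of_one_le_left hN (by exact_mod_cast hp)
      simp only [cnt, carry, mul_sub]
      omega)
  have hc : ∀ t, T.cnt (x - h) t ≤ T.cnt x t := by
    intro t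
    rw [cnt_sub]
    rcases h4 t with h5 | h5
    · have : (p : ℤ) * 1 ≤ p * h t := mul_le_mul_of_nonneg_left (h1 t) (by positivity)
      simp only [carry, h5]
      omega
    · have := (hx t).1; omega
  refine ⟨x - h, fun t => ⟨?_, (hc t).trans (hx t).2⟩, fun t => ?_, fun t => ?_, hc⟩
  · rw [cnt_sub]; have := h3 t; omega
  · have := h1 t; simp only [Pi.sub_apply] at *; omega
  · have := h2 t; simp only [Pi.sub_apply] at *; omega

end TokenSystem

/-! ### Chains of feasible vectors and nested chains -/

/-- A positive vector `D` at which `carry` is negative somewhere has a nonzero `h`, less than half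
of `D`, whose image under `carry` lies between `0` and that of `D`. -/
theorem exists_half {p f : ℕ} [NeZero f] (hp : 2 ≤ p) {D : ZMod f → ℤ} (hD : ∀ t, 1 ≤ D t)
    {j : ZMod f} (hj : carry p D j < 0) :
    ∃ h : ZMod f → ℤ, (∀ t, 0 ≤ h t) ∧ (∀ t, 2 * h t + 1 ≤ D t) ∧ 1 ≤ h (j - 1) ∧
      ∀ t, min 0 (carry p D t) ≤ carry p h t ∧ carry p h t ≤ max 0 (carry p D t) := by
  classical
  have hp' : (2 : ℤ) ≤ p := by exact_mod_cast hp
  set s : ZMod f → ℤ := Pi.single (j - 1) 1 with hs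
  have hs0 : ∀ t, 0 ≤ s t ∧ s t ≤ 1 := by
    intro t
    by_cases ht : t = j - 1
    · subst ht; simp [hs]
    · simp [hs, ht]
  have hs1 : s (j - 1) = 1 := by simp [hs]
  have hs2 : ∀ t, t ≠ j → s (t - 1) = 0 := by
    intro t ht
    have : t - 1 ≠ j - 1 := fun e => ht (sub_left_injective e)
    simp [hs, this]
  -- seed `1` at the place responsible for the negative value; `(D - 1) / 2` is an upper bound
  obtain ⟨h, h1, h2, h3, h4⟩ := exists_least_solution (p := p) s (fun t => (D t - 1) / 2)
    (fun t => max 0 (carry p D t)) (by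
      intro t
      by_cases ht : t = j - 1
      · subst ht
        have h5 := hD j
        have h6 : (2 : ℤ) * D j ≤ p * D j := mul_le_mul_of_nonneg_right hp' (by omega)
        simp only [carry] at hj
        simp only [hs1]
        omega
      · have := hD t
        have : s t = 0 := by simp [hs, ht]
        simp only [this]
        omega) (by
      intro t
      have h5 := hD t
      have h6 := hD (t - 1)
      have h7 : 2 * ((p : ℤ) * ((D t - 1) / 2)) ≤ p * D t - p := by
        have : (p : ℤ) * (2 * ((D t - 1) / 2)) ≤ p * (D t - 1) :=
          mul_le_mul_of_nonneg_left (by omega) (by omega)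
        linarith
      simp only [carry]
      rcases le_total 0 ((p : ℤ) * D t - D (t - 1)) with h8 | h8
      · rw [max_eq_right h8]; omega
      · rw [max_eq_left h8]; omega)
  have hh0 : ∀ t, 0 ≤ h t := fun t => (hs0 t).1.trans (h1 t)
  refine ⟨h, hh0, fun t => by have := h2 t; simp only at this; omega, ?_, fun t => ?_⟩
  · have := h1 (j - 1)
    rwa [hs1] at this
  · have h5 := h3 t
    refine ⟨?_, h5⟩
    rcases h4 t with h6 | h6
    · have h7 : 0 ≤ (p : ℤ) * h t := mul_nonneg (by omega) (hh0 t)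
      have h8 := hs0 (t - 1)
      simp only [carry] at *
      by_cases ht : t = j
      · subst ht; omega
      · have := hs2 t ht
        omega
    · omega

theorem sum_range_eq_of_eq_off_pair (g g' : ℕ → ℤ) (d a : ℕ) (ha : a + 1 < d)
    (h : ∀ i, i ≠ a → i ≠ a + 1 → g' i = g i) :
    ∑ i ∈ Finset.range d, g' i + (g a + g (a + 1))
      = ∑ i ∈ Finset.range d, g i + (g' a + g' (a + 1)) := by
  have ha' : a ∈ Finset.range d := Finset.mem_range.mpr (by omega)
  have ha1 : a + 1 ∈ (Finset.range d).erase a :=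
    Finset.mem_erase.mpr ⟨by omega, Finset.mem_range.mpr ha⟩
  rw [← Finset.add_sum_erase _ g ha', ← Finset.add_sum_erase _ g' ha',
    ← Finset.add_sum_erase _ g ha1, ← Finset.add_sum_erase _ g' ha1]
  have : ∑ i ∈ ((Finset.range d).erase a).erase (a + 1), g' i
      = ∑ i ∈ ((Finset.range d).erase a).erase (a + 1), g i :=
    Finset.sum_congr rfl fun i hi => by
      simp only [Finset.mem_erase] at hi
      exact h i hi.2.1 hi.1
  rw [this]; ring

namespace TokenSystem

variable {p f : ℕ} (T : TokenSystem p f)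

/-- A chain of `d` nonnegative feasible vectors, decreasing strictly at every place. -/
structure Chain (d : ℕ) (y : ℕ → ZMod f → ℤ) : Prop where
  feasible : ∀ i < d, T.Feasible (y i)
  nonneg : ∀ i < d, ∀ t, 0 ≤ y i t
  strict : ∀ i, i + 1 < d → ∀ t, y (i + 1) t + 1 ≤ y i t

/-- The chain `y` decreases on the level of tokens as well. -/
def Nested (d : ℕ) (y : ℕ → ZMod f → ℤ) : Prop :=
  ∀ i, i + 1 < d → ∀ t, T.cnt (y (i + 1)) t ≤ T.cnt (y i) t

theorem Chain.le_apply {T : TokenSystem p f} {d : ℕ} {y : ℕ → ZMod f → ℤ} (hy : T.Chain d y) :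
    ∀ j i, i + j < d → ∀ t, j ≤ y i t := by
  intro j
  induction j with
  | zero => intro i hi t; simpa using hy.nonneg i (by omega) t
  | succ j ih =>
    intro i hi t
    have h1 := ih (i + 1) (by omega) t
    have h2 := hy.strict i (by omega) t
    push_cast
    omega

variable [NeZero f]

/-- Moving two consecutive vectors of a chain towards each other, where they are not nested. The
sum of squares decreases, so that the process terminates. -/
theorem Chain.exists_smoothing {T : TokenSystem p f} (hp : 2 ≤ p) {d : ℕ} {y : ℕ → ZMod f → ℤ}
    (hy : T.Chain d y) {a : ℕ} (ha : a + 1 < d) {j : ZMod f}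
    (hj : T.cnt (y a) j < T.cnt (y (a + 1)) j) :
    ∃ z, T.Chain d z ∧
      ∑ i ∈ Finset.range d, T.cost (z i) ≤ ∑ i ∈ Finset.range d, T.cost (y i) ∧
      ∑ i ∈ Finset.range d, ∑ t, z i t ^ 2 < ∑ i ∈ Finset.range d, ∑ t, y i t ^ 2 := by
  obtain ⟨h, h1, h2, h3, h4⟩ := exists_half hp (D := y a - y (a + 1)) (j := j)
    (fun t => by have := hy.strict a ha t; simp only [Pi.sub_apply]; omega)
    (by rw [carry_sub]; simp only [cnt] at hj; omega)
  simp only [carry_sub, Pi.sub_apply] at h2 h4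
  have fa := hy.feasible a (by omega)
  have fa1 := hy.feasible (a + 1) ha
  have hsum : ∀ t, T.cnt (y a - h) t + T.cnt (y (a + 1) + h) t
      = T.cnt (y a) t + T.cnt (y (a + 1)) t := by
    intro t; rw [cnt_sub, cnt_add]; ring
  have hb : ∀ t, min (T.cnt (y a) t) (T.cnt (y (a + 1)) t) ≤ T.cnt (y a - h) t ∧
      T.cnt (y a - h) t ≤ max (T.cnt (y a) t) (T.cnt (y (a + 1)) t) := by
    intro t
    have := h4 t
    rw [cnt_sub]
    simp only [cnt]
    omega
  have hF : T.Feasible (y a - h) := by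
    intro t; have := hb t; have := fa t; have := fa1 t; omega
  have hF' : T.Feasible (y (a + 1) + h) := by
    intro t; have := hb t; have := fa t; have := fa1 t; have := hsum t; omega
  set z : ℕ → ZMod f → ℤ := fun i => if i = a then y a - h else
    if i = a + 1 then y (a + 1) + h else y i with hz
  have za : z a = y a - h := by simp [hz]
  have za1 : z (a + 1) = y (a + 1) + h := by simp [hz]
  have zo : ∀ i, i ≠ a → i ≠ a + 1 → z i = y i := fun i h5 h6 => by simp [hz, h5, h6]
  refine ⟨z, ⟨fun i hi => ?_, fun i hi t => ?_, fun i hi t => ?_⟩, ?_, ?_⟩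
  · by_cases h5 : i = a
    · subst h5; rwa [za]
    · by_cases h6 : i = a + 1
      · subst h6; rwa [za1]
      · rw [zo i h5 h6]; exact hy.feasible i hi
  · have := h1 t
    have := h2 t
    have n1 := hy.nonneg i hi t
    have n2 := hy.nonneg (a + 1) ha t
    by_cases h5 : i = a
    · subst h5; rw [za]; simp only [Pi.sub_apply]; omega
    · by_cases h6 : i = a + 1
      · subst h6; rw [za1]; simp only [Pi.add_apply]; omega
      · rw [zo i h5 h6]; exact n1
  · have := h1 t
    have := h2 t
    have n1 := hy.strict i hi t
    by_cases h5 : i = a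
    · subst h5; rw [za, za1]; simp only [Pi.sub_apply, Pi.add_apply]; omega
    · by_cases h6 : i = a + 1
      · subst h6; rw [za1, zo (a + 1 + 1) (by omega) (by omega)]; simp only [Pi.add_apply]; omega
      · rw [zo i h5 h6]
        by_cases h7 : i + 1 = a
        · rw [h7, za]; rw [h7] at n1; simp only [Pi.sub_apply]; omega
        · rw [zo _ h7 (by omega)]; exact n1
  · have e := sum_range_eq_of_eq_off_pair (fun i => T.cost (y i)) (fun i => T.cost (z i)) d a ha
      (fun i h5 h6 => by simp only [zo i h5 h6])
    have h5 := T.val_add_val_le (by omega) fa fa1 hsum hb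
    simp only [za, za1] at e
    have h6 : T.cost (y a - h) + T.cost (y (a + 1) + h) ≤ T.cost (y a) + T.cost (y (a + 1)) := h5
    zify at h6 ⊢
    linarith
  · have e := sum_range_eq_of_eq_off_pair (fun i => ∑ t, y i t ^ 2) (fun i => ∑ t, z i t ^ 2)
      d a ha (fun i h5 h6 => by simp only [zo i h5 h6])
    simp only [za, za1] at e
    have h5 : ∑ t, (y a - h) t ^ 2 + ∑ t, (y (a + 1) + h) t ^ 2
        < ∑ t, y a t ^ 2 + ∑ t, y (a + 1) t ^ 2 := by
      rw [← Finset.sum_add_distrib, ← Finset.sum_add_distrib]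
      refine Finset.sum_lt_sum (fun t _ => ?_) ⟨j - 1, Finset.mem_univ _, ?_⟩
      · have := h1 t
        have := h2 t
        simp only [Pi.sub_apply, Pi.add_apply]
        nlinarith
      · have := h2 (j - 1)
        simp only [Pi.sub_apply, Pi.add_apply]
        nlinarith
    linarith

/-- Every chain can be replaced by a nested one that is no more costly. -/
theorem Chain.exists_nested {T : TokenSystem p f} (hp : 2 ≤ p) {d : ℕ} {y : ℕ → ZMod f → ℤ}
    (hy : T.Chain d y) :
    ∃ z, T.Chain d z ∧ T.Nested d z ∧
      ∑ i ∈ Finset.range d, T.cost (z i) ≤ ∑ i ∈ Finset.range d, T.cost (y i) := by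
  obtain ⟨N, hN⟩ : ∃ N : ℕ, ∑ i ∈ Finset.range d, ∑ t, y i t ^ 2 ≤ N := by
    have h : ∀ x : ℤ, ∃ N : ℕ, x ≤ N := fun x => ⟨x.toNat, Int.self_le_toNat x⟩
    exact h _
  induction N using Nat.strong_induction_on generalizing y with
  | _ N ih =>
    by_cases hn : T.Nested d y
    · exact ⟨y, hy, hn, le_rfl⟩
    · simp only [Nested] at hn
      push Not at hn
      obtain ⟨a, ha, j, hj⟩ := hn
      obtain ⟨z, hz, hc, hlt⟩ := hy.exists_smoothing hp ha hj
      have h0 : (0 : ℤ) ≤ ∑ i ∈ Finset.range d, ∑ t, z i t ^ 2 :=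
        Finset.sum_nonneg fun i _ => Finset.sum_nonneg fun t _ => sq_nonneg _
      obtain ⟨M, hM⟩ := Int.eq_ofNat_of_zero_le h0
      have hMN : M < N := by
        have := hlt.trans_le hN
        rw [hM] at this
        exact_mod_cast this
      obtain ⟨z', h1, h2, h3⟩ := ih M hMN hz hM.le
      exact ⟨z', h1, h2, h3.trans hc⟩

end TokenSystem

/-! ### Making a chain cheaper when its first vector is not optimal -/

theorem sum_zmod_eq_sum_range {M : Type*} [AddCommMonoid M] {f : ℕ} [NeZero f] (G : ZMod f → M)
    (t₀ : ZMod f) : ∑ t, G t = ∑ i ∈ Finset.range f, G (t₀ + i) := by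
  rw [← Equiv.sum_comp (Equiv.addLeft t₀) G]
  refine Finset.sum_nbij' (fun t => ZMod.val t) (fun i => (i : ZMod f)) ?_ ?_ ?_ ?_ ?_
  · intro t _; exact Finset.mem_range.mpr (ZMod.val_lt t)
  · intro i _; exact Finset.mem_univ _
  · intro t _; exact ZMod.natCast_zmod_val t
  · intro i hi; exact ZMod.val_cast_of_lt (Finset.mem_range.mp hi)
  · intro t _; simp

namespace TokenSystem

variable {p f : ℕ} [NeZero f] (T : TokenSystem p f)

/-- If `b` is cheapest among the feasible vectors above it and is worth more than `u ≤ b`, then it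
is so by a margin of at least `p ^ (e - (f - 1))`, where `e` is the highest level at which the
two differ. -/
theorem pow_add_cost_le (hp : 2 ≤ p) {u b : ZMod f → ℤ} (hu : T.Feasible u) (hb : T.Feasible b)
    (hmin : ∀ x, T.Feasible x → b ≤ x → T.cost b ≤ T.cost x) {s : ZMod f} {e : ℕ}
    (hs : T.cnt u s < T.cnt b s) (he : T.lev s (T.cnt b s - 1).toNat = e)
    (hrem : ∀ t r, (T.cnt b t).toNat ≤ r → r < (T.cnt u t).toNat → T.lev t r < e) :
    p ^ e + p ^ (f - 1) * T.cost u ≤ p ^ (f - 1) * T.cost b := by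
  have hfpos := NeZero.pos f
  have hus := hu s
  have hbs := hb s
  have hes : (e : ZMod f) = s := by rw [← he]; exact T.lev_cast s _ (by omega)
  set ℓ : ZMod f → ℤ := fun t => max 0 (T.cnt u t - T.cnt b t) with hℓ
  have hℓ0 : ∀ t, 0 ≤ ℓ t := fun t => le_max_left _ _
  -- otherwise tokens removed from `u` could be exchanged for the top token of `b`
  have hlight : ∑ i ∈ Finset.range (f - 1), (p : ℤ) ^ i * ℓ (s + 1 + i) < (p : ℤ) ^ (f - 1) := by
    by_contra! hcon
    obtain ⟨h, h1, h2, h3⟩ := exists_exchange hp ℓ s hℓ0 hcon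
    have hF : T.Feasible (b + h) := by
      intro t
      rw [cnt_add]
      have := hu t; have := hb t
      by_cases ht : t = s
      · subst ht; omega
      · have := h3 t ht
        simp only [hℓ] at this
        omega
    have hle := hmin _ hF (fun t => by
      have := h1 t
      simp only [Pi.add_apply, Pi.zero_apply] at *
      omega)
    have hv := T.val_add_gain (T.cnt b) (T.cnt (b + h))
    have hg1 : T.gain (T.cnt b) (T.cnt (b + h)) < p ^ e := by
      refine T.gain_lt_pow hp (fun t => (hF t).2) e fun t r hr1 hr2 => ?_
      rw [cnt_add] at hr2
      by_cases ht : t = s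
      · subst ht; omega
      · have := h3 t ht
        simp only [hℓ] at this
        exact hrem t r hr1 (by omega)
    have hg2 : p ^ T.lev s (T.cnt b s - 1).toNat ≤ T.gain (T.cnt (b + h)) (T.cnt b) := by
      refine T.pow_le_gain s _ ?_ (by omega)
      rw [cnt_add, h2]
      omega
    rw [he] at hg2
    simp only [cost] at hle
    omega
  have hgain : p ^ (f - 1) * T.gain (T.cnt b) (T.cnt u)
      ≤ ∑ i ∈ Finset.range (f - 1), p ^ e * (p ^ i * (ℓ (s + 1 + i)).toNat) := by
    have hsplit : T.gain (T.cnt b) (T.cnt u) = ∑ i ∈ Finset.range (f - 1),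
        ∑ r ∈ Finset.Ico (T.cnt b (s + 1 + i)).toNat (T.cnt u (s + 1 + i)).toNat,
          p ^ T.lev (s + 1 + i) r := by
      have h1 : f = (f - 1) + 1 := by omega
      have hlast : s + 1 + ((f - 1 : ℕ) : ZMod f) = s := by
        have : ((f - 1 + 1 : ℕ) : ZMod f) = 0 := by rw [← h1]; exact ZMod.natCast_self _
        rw [Nat.cast_add, Nat.cast_one] at this
        rw [add_assoc, add_comm 1, this, add_zero]
      have h2 : ∀ F : ℕ → ℕ, ∑ i ∈ Finset.range f, F i
          = ∑ i ∈ Finset.range (f - 1), F i + F (f - 1) := by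
        intro F; conv_lhs => rw [h1]
        exact Finset.sum_range_succ _ _
      unfold gain
      rw [sum_zmod_eq_sum_range _ (s + 1), h2, hlast,
        Finset.Ico_eq_empty_of_le (by omega : (T.cnt u s).toNat ≤ (T.cnt b s).toNat),
        Finset.sum_empty, add_zero]
    rw [hsplit, Finset.mul_sum]
    refine Finset.sum_le_sum fun i hi => ?_
    have hi := Finset.mem_range.mp hi
    have hbt := hb (s + 1 + i)
    have hut := hu (s + 1 + i)
    have hcard : (ℓ (s + 1 + i)).toNat
        = (Finset.Ico (T.cnt b (s + 1 + i)).toNat (T.cnt u (s + 1 + i)).toNat).card := by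
      rw [Nat.card_Ico]
      simp only [hℓ]
      omega
    rw [Finset.mul_sum, hcard, ← mul_assoc, mul_comm (p ^ e * p ^ i), ← smul_eq_mul]
    refine Finset.sum_le_card_nsmul _ _ _ fun r hr => ?_
    rw [Finset.mem_Ico] at hr
    rw [← pow_add, ← pow_add]
    refine Nat.pow_le_pow_right (by omega) ?_
    -- the level of a removed token of type `s + 1 + i` is below `e` and congruent to `e + 1 + i`
    have hlt := hrem _ r hr.1 hr.2
    have hc := T.lev_cast (s + 1 + i) r (by omega)
    set l := T.lev (s + 1 + i) r with hl
    have hmod : ((e - l + 1 + i : ℕ) : ZMod f) = 0 := by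
      push_cast [Nat.cast_sub hlt.le]
      rw [hc, hes]; ring
    rw [ZMod.natCast_eq_zero_iff] at hmod
    have := Nat.le_of_dvd (by omega) hmod
    omega
  have hv := T.val_add_gain (T.cnt u) (T.cnt b)
  have hL : ∑ i ∈ Finset.range (f - 1), p ^ i * (ℓ (s + 1 + i)).toNat + 1 ≤ p ^ (f - 1) := by
    have : ∑ i ∈ Finset.range (f - 1), p ^ i * (ℓ (s + 1 + i)).toNat < p ^ (f - 1) := by
      zify
      have : ∀ i : ℕ, ((ℓ (s + 1 + i)).toNat : ℤ) = ℓ (s + 1 + i) :=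
        fun i => Int.toNat_of_nonneg (hℓ0 _)
      simpa only [this] using hlight
    omega
  rw [← Finset.mul_sum] at hgain
  have h1 := Nat.mul_le_mul_left (p ^ e) hL
  have hg2 : p ^ e ≤ T.gain (T.cnt u) (T.cnt b) := by
    rw [← he]; exact T.pow_le_gain s _ (by omega) (by omega)
  have h2 : p ^ (f - 1) * p ^ e ≤ p ^ (f - 1) * T.gain (T.cnt u) (T.cnt b) :=
    Nat.mul_le_mul_left _ hg2
  have h3 : p ^ (f - 1) * (T.cost u + T.gain (T.cnt u) (T.cnt b))
      = p ^ (f - 1) * (T.cost b + T.gain (T.cnt b) (T.cnt u)) := by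
    simp only [cost]; rw [hv]
  rw [mul_add, mul_add] at h3
  have h4 : p ^ (f - 1) * p ^ e = p ^ e * p ^ (f - 1) := mul_comm _ _
  rw [mul_add, mul_one] at h1
  omega

/-- If `u` is cheapest among the feasible vectors above it and `b ≥ u` exceeds `u` at `k`, then
the tokens of type `k + 1` counted by `u` lie below the highest level at which the two differ. -/
theorem lev_lt_of_lt (hp : 2 ≤ p) {u b : ZMod f → ℤ} (hu : T.Feasible u) (hb : T.Feasible b)
    (hmin : ∀ x, T.Feasible x → u ≤ x → T.cost u ≤ T.cost x) {e : ℕ}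
    (hadd : ∀ t r, (T.cnt u t).toNat ≤ r → r < (T.cnt b t).toNat → T.lev t r ≤ e)
    (hrem : ∀ t r, (T.cnt b t).toNat ≤ r → r < (T.cnt u t).toNat → T.lev t r < e)
    {t₀ : ZMod f} (hk : u (t₀ - 1) < b (t₀ - 1)) (hc : 1 ≤ T.cnt u t₀) :
    T.lev t₀ (T.cnt u t₀ - 1).toNat < e := by
  -- otherwise the top token of type `t₀` in `u` can be exchanged for tokens of `b` not in `u`
  by_contra! hcon
  have hfpos := NeZero.pos f
  have hp' : (2 : ℤ) ≤ p := by exact_mod_cast hp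
  have hut := hu t₀
  have hbt := hb t₀
  set e₀ := T.lev t₀ (T.cnt u t₀ - 1).toNat with he₀
  have hget : (e₀ : ZMod f) = t₀ := T.lev_cast t₀ _ (by omega)
  have hL : ∀ t, carry p (b - u) t = T.cnt b t - T.cnt u t := by
    intro t; rw [carry_sub]; simp only [cnt]; ring
  have h0 : T.cnt u t₀ ≤ T.cnt b t₀ := by
    by_contra! h
    have := hrem t₀ (T.cnt u t₀ - 1).toNat (by omega) (by omega)
    omega
  have h1 : T.cnt b t₀ - T.cnt u t₀ ≤ p - 2 := by
    by_contra! h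
    have h2 := T.lev_gap t₀ (T.cnt u t₀ - 1).toNat (by omega)
    have h3 := hadd t₀ ((T.cnt u t₀ - 1).toNat + (p - 1)) (by omega) (by omega)
    omega
  set ℓ : ZMod f → ℤ := fun t => max 0 (T.cnt b t - T.cnt u t) with hℓ
  have hbig : (p : ℤ) ^ (f - 1)
      ≤ ∑ i ∈ Finset.range (f - 1), (p : ℤ) ^ i * ℓ (t₀ + 1 + i) := by
    have hsum : ∑ i ∈ Finset.range (f - 1), (p : ℤ) ^ i * carry p (b - u) (t₀ + 1 + i)
        ≤ ∑ i ∈ Finset.range (f - 1), (p : ℤ) ^ i * ℓ (t₀ + 1 + i) := by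
      refine Finset.sum_le_sum fun i _ => mul_le_mul_of_nonneg_left ?_ (by positivity)
      rw [hL]; exact le_max_right _ _
    have hu0 := uncarry_carry p (b - u) t₀
    have hf1 : f = (f - 1) + 1 := by omega
    have hlast : t₀ + 1 + ((f - 1 : ℕ) : ZMod f) = t₀ := by
      have : ((f - 1 + 1 : ℕ) : ZMod f) = 0 := by rw [← hf1]; exact ZMod.natCast_self _
      rw [Nat.cast_add, Nat.cast_one] at this
      rw [add_assoc, add_comm 1, this, add_zero]
    have h2 : ∀ F : ℕ → ℤ, ∑ i ∈ Finset.range f, F i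
        = ∑ i ∈ Finset.range (f - 1), F i + F (f - 1) := by
      intro F; conv_lhs => rw [hf1]
      exact Finset.sum_range_succ _ _
    unfold uncarry at hu0
    rw [h2, hlast] at hu0
    have hpf : (p : ℤ) ^ f = p ^ (f - 1) * p := by
      conv_lhs => rw [hf1]
      exact pow_succ _ _
    set S := ∑ i ∈ Finset.range (f - 1), (p : ℤ) ^ i * carry p (b - u) (t₀ + 1 + i) with hS
    set P := (p : ℤ) ^ (f - 1) with hP
    have hP1 : 1 ≤ P := one_le_pow₀ (by omega)
    -- multiply by `p` and use `p w_t = carry w t + w_{t-1}` for `w = b - u`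
    have hc0 : (p : ℤ) * (b - u) t₀ = carry p (b - u) t₀ + (b - u) (t₀ - 1) := by
      simp only [carry]; ring
    have hw : 1 ≤ (b - u) (t₀ - 1) := by simp only [Pi.sub_apply]; omega
    have hcc := hL t₀
    set c := carry p (b - u) t₀ with hcdef
    have e1 : p * S = (P * p - 1) * (b - u) (t₀ - 1) - c := by
      have : p * (S + P * c) = (P * p - 1) * (p * (b - u) t₀) := by rw [hu0, hpf]; ring
      rw [hc0] at this
      linarith
    have e2 : (P * p - 1) * 1 ≤ (P * p - 1) * (b - u) (t₀ - 1) :=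
      mul_le_mul_of_nonneg_left hw (by nlinarith)
    have e3 : (p : ℤ) * (P - 1) < p * S := by linarith
    have := lt_of_mul_lt_mul_left e3 (by omega)
    omega
  obtain ⟨h, g1, g2, g3⟩ := exists_exchange hp ℓ t₀ (fun t => le_max_left _ _) hbig
  have hF : T.Feasible (u + h) := by
    intro t
    rw [cnt_add]
    have := hu t; have := hb t
    by_cases ht : t = t₀
    · subst ht; omega
    · have := g3 t ht
      simp only [hℓ] at this
      omega
  have hle := hmin _ hF (fun t => by
    have := g1 t
    simp only [Pi.add_apply, Pi.zero_apply] at *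
    omega)
  have hv := T.val_add_gain (T.cnt u) (T.cnt (u + h))
  have hg1 : T.gain (T.cnt u) (T.cnt (u + h)) < p ^ e₀ := by
    refine T.gain_lt_pow hp (fun t => (hF t).2) e₀ fun t r hr1 hr2 => ?_
    have hr3 := (hF t).2
    have hr4 := T.lev_cast t r (by omega)
    rw [cnt_add] at hr2
    by_cases ht : t = t₀
    · subst ht; omega
    · have := g3 t ht
      simp only [hℓ] at this
      have := hadd t r hr1 (by omega)
      refine lt_of_le_of_ne (by omega) fun heq => ht ?_
      rw [← hr4, heq, hget]
  have hg2 : p ^ e₀ ≤ T.gain (T.cnt (u + h)) (T.cnt u) := by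
    refine T.pow_le_gain t₀ _ ?_ (by omega)
    rw [cnt_add, g2]
    omega
  simp only [cost] at hle
  omega

end TokenSystem

theorem mul_sum_le_of_pow_mul_le {q M : ℕ} (hq : 1 ≤ q) (V : ℕ → ℕ) (m : ℕ)
    (hV : ∀ i < m, q ^ (i + 1) * V i ≤ M) : (q - 1) * ∑ i ∈ Finset.range m, V i ≤ M := by
  obtain ⟨r, rfl⟩ : ∃ r, q = r + 1 := ⟨q - 1, by omega⟩
  have h : ∀ n ≤ m, (r + 1) ^ n * (r * ∑ i ∈ Finset.range n, V i) + M ≤ (r + 1) ^ n * M := by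
    intro n
    induction n with
    | zero => intro _; simp
    | succ n ih =>
      intro hn
      have h1 := ih (by omega)
      have h2 := hV n (by omega)
      rw [Finset.sum_range_succ]
      have h3 := Nat.mul_le_mul_left r h2
      have h4 := Nat.mul_le_mul_left (r + 1) h1
      rw [pow_succ] at *
      nlinarith
  have h1 := h m le_rfl
  have h2 : 0 < (r + 1) ^ m := by positivity
  have h3 : (r + 1) ^ m * (r * ∑ i ∈ Finset.range m, V i) ≤ (r + 1) ^ m * M := by omega
  simpa using Nat.le_of_mul_le_mul_left h3 h2

namespace TokenSystem

variable {p f : ℕ} [NeZero f] (T : TokenSystem p f)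

/-- Pushing `y` below `x`: the largest feasible vector below both `y` and `x - 1`, in the sense
that a place where it is smaller than both is followed by a type of which it uses no token. -/
theorem exists_push_below (hp : 2 ≤ p) {x y : ZMod f → ℤ} (hx : T.Feasible x) (hy : T.Feasible y)
    {N : ℤ} (hN : 0 ≤ N) (hxN : ∀ t, N + 1 ≤ x t) (hyN : ∀ t, N ≤ y t) :
    ∃ z, T.Feasible z ∧ (∀ t, z t + 1 ≤ x t) ∧ (∀ t, N ≤ z t) ∧ (∀ t, z t ≤ y t) ∧
      ∀ t, T.cnt z t = 0 ∨ z (t - 1) = min (y (t - 1)) (x (t - 1) - 1) := by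
  have hp' : (2 : ℤ) ≤ p := by exact_mod_cast hp
  obtain ⟨w, w1, w2, w3, w4⟩ := T.exists_feasible_lt (by omega) hx hN hxN
  obtain ⟨h, h1, h2, h3, h4⟩ := exists_least_solution (p := p)
    (fun t => max 0 (y t - x t + 1)) (fun t => max 0 (y t - w t)) (T.cnt y)
    (fun t => by have := w2 t; simp only; omega) (by
      intro t
      have hyt := hy t
      have hwt := w1 t
      simp only [carry]
      rcases le_total 0 (y t - w t) with h | h
      · rw [max_eq_right h]
        simp only [cnt, carry] at *
        rw [mul_sub]
        omega
      · rw [max_eq_left h]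
        omega)
  have hh0 : ∀ t, 0 ≤ h t := fun t => (le_max_left _ _).trans (h1 t)
  have hzx : ∀ t, (y - h) t + 1 ≤ x t := by
    intro t; have := h1 t; simp only [Pi.sub_apply] at *; omega
  have hzy : ∀ t, (y - h) t ≤ y t := by
    intro t; have := hh0 t; simp only [Pi.sub_apply] at *; omega
  have hdich : ∀ t, T.cnt (y - h) t = 0 ∨ (y - h) (t - 1) = min (y (t - 1)) (x (t - 1) - 1) := by
    intro t
    rcases h4 t with h5 | h5
    · right; simp only [Pi.sub_apply]; omega
    · left; rw [cnt_sub]; omega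
  refine ⟨y - h, fun t => ?_, hzx, fun t => ?_, hzy, hdich⟩
  · refine ⟨by rw [cnt_sub]; have := h3 t; omega, ?_⟩
    rcases hdich t with h5 | h5
    · rw [h5]; positivity
    · have m1 : (p : ℤ) * (y - h) t ≤ p * (x t - 1) :=
        mul_le_mul_of_nonneg_left (by have := hzx t; omega) (by omega)
      have m2 : (p : ℤ) * (y - h) t ≤ p * y t := mul_le_mul_of_nonneg_left (hzy t) (by omega)
      have hyt := hy t
      have hxt := hx t
      rw [mul_sub] at m1
      simp only [cnt, carry] at *
      omega
  · have := h2 t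
    have := w3 t
    have := hyN t
    simp only [Pi.sub_apply] at *
    omega

/-- The chain obtained by pushing the `y i` below each other, starting from `u`. The tokens it
uses in excess of `y` have levels so low that they are paid for by replacing `b` with `u`. -/
theorem Chain.exists_pushed {T : TokenSystem p f} (hp : 2 ≤ p) {d : ℕ} {y : ℕ → ZMod f → ℤ}
    (hy : T.Chain (d + 1) y) {u b : ZMod f → ℤ} (hu : T.Feasible u) (hud : ∀ t, (d : ℤ) ≤ u t)
    (hb : 0 < d → ∀ t, y 1 t + 1 ≤ b t) {e : ℕ}
    (hlev : ∀ t, u (t - 1) < b (t - 1) → 1 ≤ T.cnt u t →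
      T.lev t (T.cnt u t - 1).toNat < e) :
    ∃ v, T.Chain (d + 1) v ∧ v 0 = u ∧
      (p ^ f - 1) * ∑ i ∈ Finset.range d, T.cost (v (i + 1)) + 1
        ≤ (p ^ f - 1) * ∑ i ∈ Finset.range d, T.cost (y (i + 1)) + p ^ e := by
  have hp' : (2 : ℤ) ≤ p := by exact_mod_cast hp
  have step : ∀ (i : ℕ) (x : ZMod f → ℤ), ∃ z, i < d → T.Feasible x →
      (∀ t, (d : ℤ) - i ≤ x t) → T.Feasible z ∧ (∀ t, z t + 1 ≤ x t) ∧
      (∀ t, (d : ℤ) - (i + 1 : ℕ) ≤ z t) ∧ (∀ t, z t ≤ y (i + 1) t) ∧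
      ∀ t, T.cnt z t = 0 ∨ z (t - 1) = min (y (i + 1) (t - 1)) (x (t - 1) - 1) := by
    intro i x
    by_cases h : i < d ∧ T.Feasible x ∧ ∀ t, (d : ℤ) - i ≤ x t
    · obtain ⟨z, hz⟩ := T.exists_push_below hp h.2.1 (hy.feasible (i + 1) (by omega))
        (N := (d : ℤ) - (i + 1 : ℕ)) (by push_cast; omega)
        (fun t => by have := h.2.2 t; push_cast; omega)
        (fun t => by
          have := hy.le_apply (d - (i + 1)) (i + 1) (by omega) t
          omega)
      exact ⟨z, fun _ _ _ => hz⟩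
    · exact ⟨0, fun h1 h2 h3 => absurd ⟨h1, h2, h3⟩ h⟩
  choose g hg using step
  set v : ℕ → ZMod f → ℤ := fun i => Nat.rec u g i with hv
  have hv0 : v 0 = u := rfl
  have hvs : ∀ i, v (i + 1) = g i (v i) := fun i => rfl
  have hgood : ∀ i, i ≤ d → T.Feasible (v i) ∧ ∀ t, (d : ℤ) - i ≤ v i t := by
    intro i
    induction i with
    | zero => intro _; rw [hv0]; exact ⟨hu, by simpa using hud⟩
    | succ i ih =>
      intro hi
      obtain ⟨h1, h2⟩ := ih (by omega)
      have h3 := hg i (v i) (by omega) h1 h2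
      rw [hvs]
      exact ⟨h3.1, h3.2.2.1⟩
  have hnext : ∀ i < d, (∀ t, v (i + 1) t + 1 ≤ v i t) ∧
      ∀ t, T.cnt (v (i + 1)) t = 0 ∨
        v (i + 1) (t - 1) = min (y (i + 1) (t - 1)) (v i (t - 1) - 1) := by
    intro i hi
    have h3 := hg i (v i) hi (hgood i hi.le).1 (hgood i hi.le).2
    rw [hvs]
    exact ⟨h3.2.1, h3.2.2.2.2⟩
  -- wherever `v` falls strictly below `y`, it has lost `p - 1` tokens per step since `u`
  have hinv : ∀ i < d, ∀ t, v (i + 1) (t - 1) < y (i + 1) (t - 1) → T.cnt (v (i + 1)) t ≠ 0 →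
      T.cnt (v (i + 1)) t + (i + 1 : ℕ) * ((p : ℤ) - 1) ≤ T.cnt u t ∧ u (t - 1) < b (t - 1) := by
    intro i
    induction i with
    | zero =>
      intro hi t h1 h2
      obtain ⟨h3, h4⟩ := hnext 0 hi
      have h5 := (h4 t).resolve_left h2
      have h6 : (p : ℤ) * v (0 + 1) t ≤ p * (v 0 t - 1) :=
        mul_le_mul_of_nonneg_left (by have := h3 t; omega) (by omega)
      have h7 := hb hi (t - 1)
      rw [mul_sub, hv0] at h6
      rw [hv0] at h5
      simp only [cnt, carry, zero_add, Nat.cast_one, one_mul] at *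
      omega
    | succ i ih =>
      intro hi t h1 h2
      obtain ⟨h3, h4⟩ := hnext (i + 1) hi
      have h5 := (h4 t).resolve_left h2
      have h6 : (p : ℤ) * v (i + 1 + 1) t ≤ p * (v (i + 1) t - 1) :=
        mul_le_mul_of_nonneg_left (by have := h3 t; omega) (by omega)
      have h7 := hy.strict (i + 1) (by omega) (t - 1)
      have h9 := ((hgood (i + 1 + 1) (by omega)).1 t).1
      rw [mul_sub] at h6
      have h8 : T.cnt (v (i + 1 + 1)) t + (p - 1) ≤ T.cnt (v (i + 1)) t := by
        simp only [cnt, carry]; omega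
      have h10 := ih (by omega) t (by omega) (by omega)
      refine ⟨?_, h10.2⟩
      have := h10.1
      push_cast at this ⊢
      linarith
  have hgain : ∀ i < d, (p ^ f) ^ (i + 1) * T.gain (T.cnt (y (i + 1))) (T.cnt (v (i + 1)))
      ≤ p ^ e - 1 := by
    intro i hi
    have hF := (hgood (i + 1) (by omega)).1
    have hyF := hy.feasible (i + 1) (by omega)
    have hl : ∀ t r, (T.cnt (y (i + 1)) t).toNat ≤ r → r < (T.cnt (v (i + 1)) t).toNat →
        T.lev t r + (i + 1) * f < e := by
      intro t r h1 h2
      have h4 : v (i + 1) (t - 1) < y (i + 1) (t - 1) := by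
        have h5 : v (i + 1) t ≤ y (i + 1) t := by
          have := hg i (v i) hi (hgood i hi.le).1 (hgood i hi.le).2
          rw [hvs]; exact this.2.2.2.1 t
        have h6 : (p : ℤ) * v (i + 1) t ≤ p * y (i + 1) t :=
          mul_le_mul_of_nonneg_left h5 (by omega)
        simp only [cnt, carry] at h1 h2
        omega
      obtain ⟨h5, h6⟩ := hinv i hi t h4 (by omega)
      have hut := hu t
      have h7 : 0 ≤ ((i + 1 : ℕ) : ℤ) * ((p : ℤ) - 1) := mul_nonneg (by positivity) (by omega)
      have h8 := hlev t h6 (by omega)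
      have h9 : r + (i + 1) * (p - 1) ≤ (T.cnt u t - 1).toNat := by
        have : (((i + 1) * (p - 1) : ℕ) : ℤ) = ((i + 1 : ℕ) : ℤ) * ((p : ℤ) - 1) := by
          push_cast [show 1 ≤ p by omega]; ring
        omega
      have h10 := T.lev_mono t _ _ h9 (by omega)
      have h11 := T.lev_add_le (t := t) (r := r) (i + 1) (by omega)
      omega
    have hpos : 0 < p ^ e := by positivity
    by_cases he : (i + 1) * f ≤ e
    · have h1 := T.gain_lt_pow hp (fun t => (hF t).2) (e - (i + 1) * f)
        (fun t r h1 h2 => by have := hl t r h1 h2; omega)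
      have h2 : (p ^ f) ^ (i + 1) * p ^ (e - (i + 1) * f) = p ^ e := by
        rw [← pow_mul, ← pow_add]; congr 1; rw [mul_comm f]; omega
      have h3 := Nat.mul_lt_mul_of_pos_left h1 (show 0 < (p ^ f) ^ (i + 1) by positivity)
      omega
    · have h1 : T.gain (T.cnt (y (i + 1))) (T.cnt (v (i + 1))) = 0 := by
        have := T.gain_lt_pow hp (c := T.cnt (y (i + 1))) (fun t => (hF t).2) 0
          (fun t r h1 h2 => by have := hl t r h1 h2; omega)
        simpa using this
      rw [h1]; omega
  refine ⟨v, ⟨fun i hi => (hgood i (by omega)).1, fun i hi t => ?_,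
    fun i hi => (hnext i (by omega)).1⟩, rfl, ?_⟩
  · have := (hgood i (by omega)).2 t; omega
  · have hq : 1 ≤ p ^ f := Nat.one_le_pow _ _ (by omega)
    have h1 := mul_sum_le_of_pow_mul_le hq
      (fun i => T.gain (T.cnt (y (i + 1))) (T.cnt (v (i + 1)))) d hgain
    have h2 : ∑ i ∈ Finset.range d, T.cost (v (i + 1)) ≤ ∑ i ∈ Finset.range d,
        T.cost (y (i + 1)) + ∑ i ∈ Finset.range d,
          T.gain (T.cnt (y (i + 1))) (T.cnt (v (i + 1))) := by
      rw [← Finset.sum_add_distrib]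
      refine Finset.sum_le_sum fun i _ => ?_
      have := T.val_add_gain (T.cnt (y (i + 1))) (T.cnt (v (i + 1)))
      simp only [cost]; omega
    have h3 := Nat.mul_le_mul_left (p ^ f - 1) h2
    rw [mul_add] at h3
    have : 0 < p ^ e := by positivity
    omega

theorem exists_min_cost {Q : (ZMod f → ℤ) → Prop} (hQ : ∃ x, Q x) :
    ∃ x, Q x ∧ ∀ y, Q y → T.cost x ≤ T.cost y := by
  obtain ⟨x, hx, hmin⟩ := (measure T.cost).wf.has_min {x | Q x} hQ
  exact ⟨x, hx, fun y hy => not_lt.mp (hmin y hy)⟩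

/-- A chain whose first vector is not cheapest among the feasible vectors that leave room for a
chain of the same length below them is not a cheapest chain. -/
theorem Chain.exists_cheaper {T : TokenSystem p f} (hp : 2 ≤ p) {d : ℕ} {y : ℕ → ZMod f → ℤ}
    (hy : T.Chain (d + 1) y) {x : ZMod f → ℤ} (hx : T.Feasible x) (hxd : ∀ t, (d : ℤ) ≤ x t)
    (hlt : T.cost x < T.cost (y 0)) :
    ∃ z, T.Chain (d + 1) z ∧
      ∑ i ∈ Finset.range (d + 1), T.cost (z i) < ∑ i ∈ Finset.range (d + 1), T.cost (y i) := by
  obtain ⟨u, ⟨hu, hud⟩, humin⟩ :=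
    T.exists_min_cost (Q := fun x => T.Feasible x ∧ ∀ t, (d : ℤ) ≤ x t) ⟨x, hx, hxd⟩
  have hux := (humin x ⟨hx, hxd⟩).trans_lt hlt
  have hy0 := hy.feasible 0 (by omega)
  have hy0d : ∀ t, (d : ℤ) ≤ y 0 t := hy.le_apply d 0 (by omega)
  obtain ⟨hinf, hsup, hsub⟩ := T.inf_sup hp hy0 hu
  have hinfd := humin _ ⟨hinf, fun t => by
    have := hud t; have := hy0d t; simp only [Pi.inf_apply]; omega⟩
  -- `b` lies above `u` and above `y 1`, and submodularity makes it no more costly than `y 0`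
  obtain ⟨b, ⟨hb, hub, hb1⟩, hbmin⟩ := T.exists_min_cost
    (Q := fun x => T.Feasible x ∧ u ≤ x ∧ (0 < d → ∀ t, y 1 t + 1 ≤ x t))
    ⟨y 0 ⊔ u, hsup, le_sup_right, fun hd t => by
      have := hy.strict 0 (by omega) t; simp only [Pi.sup_apply, zero_add] at *; omega⟩
  have hby0 := hbmin _ ⟨hsup, le_sup_right, fun hd t => by
      have := hy.strict 0 (by omega) t; simp only [Pi.sup_apply, zero_add] at *; omega⟩
  by_cases hbu : b = u
  · subst hbu
    refine ⟨fun i => if i = 0 then b else y i, ⟨fun i hi => ?_, fun i hi t => ?_,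
      fun i hi t => ?_⟩, ?_⟩
    · by_cases h : i = 0
      · simpa [h] using hb
      · simpa [h] using hy.feasible i hi
    · by_cases h : i = 0
      · have := hud t
        simp only [h, if_true]; omega
      · simpa [h] using hy.nonneg i hi t
    · by_cases h : i = 0
      · have := hb1 (by omega) t
        simpa [h] using this
      · simpa [h] using hy.strict i hi t
    · rw [Finset.sum_range_succ', Finset.sum_range_succ' (fun i => T.cost (y i))]
      simpa using hux
  · have hle : T.cost u ≤ T.cost b :=
      humin b ⟨hb, fun t => (hud t).trans (hub t)⟩
    obtain ⟨s, e, hs, he, hadd, hrem⟩ := T.exists_top hp hu hb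
      (fun h => hbu (T.cnt_injective hp h).symm) hle
    have hmargin := T.pow_add_cost_le hp hu hb
      (fun x hx hbx => hbmin x ⟨hx, hub.trans hbx, fun hd t => (hb1 hd t).trans (hbx t)⟩)
      hs he hrem
    obtain ⟨v, hv, hv0, hcost⟩ := hy.exists_pushed hp hu hud hb1 (e := e) (fun t hk hc =>
      T.lev_lt_of_lt hp hu hb
        (fun x hx hux => humin x ⟨hx, fun t => (hud t).trans (hux t)⟩) hadd hrem hk hc)
    refine ⟨v, hv, ?_⟩
    rw [Finset.sum_range_succ', Finset.sum_range_succ' (fun i => T.cost (y i)), hv0]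
    set A := ∑ i ∈ Finset.range d, T.cost (v (i + 1))
    set B := ∑ i ∈ Finset.range d, T.cost (y (i + 1))
    -- `p ^ (f - 1) ≤ p ^ f - 1`, so the excess of `A` over `B` is below the margin
    have hf : p ^ f = p ^ (f - 1) * p := by
      rw [← pow_succ]; congr 1; have := NeZero.pos f; omega
    have hpos : 0 < p ^ (f - 1) := by positivity
    have hq : p ^ (f - 1) ≤ p ^ f - 1 := by
      rw [hf]
      have := Nat.mul_le_mul_left (p ^ (f - 1)) hp
      omega
    by_contra! hcon
    have h1 : B + T.cost b ≤ A + T.cost u := by omega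
    have h2 : p ^ (f - 1) * (B + T.cost b) ≤ p ^ (f - 1) * (A + T.cost u) :=
      Nat.mul_le_mul_left _ h1
    have hBA : B ≤ A := by omega
    obtain ⟨D, hD⟩ := Nat.exists_eq_add_of_le hBA
    rw [hD] at hcost h2
    have h3 := Nat.mul_le_mul_right D hq
    rw [mul_add] at hcost
    have h4 : p ^ (f - 1) * (B + D + T.cost u)
        = p ^ (f - 1) * B + p ^ (f - 1) * D + p ^ (f - 1) * T.cost u := by ring
    rw [h4, mul_add] at h2
    omega

end TokenSystem

/-! ### Digits and the digitwise order -/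

/-- The base-`p` digit of `k` at position `l`. -/
def digit (p k l : ℕ) : ℕ := k / p ^ l % p

/-- The digitwise order in base `p`. -/
def Digitwise (p m k : ℕ) : Prop := ∀ l, digit p m l ≤ digit p k l

theorem Digitwise.trans {p a b c : ℕ} (h : Digitwise p a b) (h' : Digitwise p b c) :
    Digitwise p a c := fun l => (h l).trans (h' l)

theorem digit_lt {p : ℕ} (hp : 2 ≤ p) (k l : ℕ) : digit p k l < p := Nat.mod_lt _ (by omega)

theorem digit_eq_zero {p k l : ℕ} (h : k < p ^ l) : digit p k l = 0 := by
  simp [digit, Nat.div_eq_of_lt h]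

theorem digit_eq_zero_of_le {p : ℕ} (hp : 2 ≤ p) {k l : ℕ} (h : k ≤ l) : digit p k l = 0 :=
  digit_eq_zero ((Nat.lt_pow_self (by omega)).trans_le (Nat.pow_le_pow_right (by omega) h))

theorem sum_digit_mul_pow (p k K : ℕ) :
    ∑ l ∈ Finset.range K, digit p k l * p ^ l = k % p ^ K := by
  induction K with
  | zero => simp [Nat.mod_one]
  | succ K ih => rw [Finset.sum_range_succ, ih, Nat.mod_pow_succ, digit, mul_comm (p ^ K)]

theorem sum_digit_mul_pow_of_le {p : ℕ} (hp : 2 ≤ p) {k K : ℕ} (h : k ≤ K) :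
    ∑ l ∈ Finset.range K, digit p k l * p ^ l = k := by
  rw [sum_digit_mul_pow, Nat.mod_eq_of_lt]
  exact (Nat.lt_pow_self (by omega)).trans_le (Nat.pow_le_pow_right (by omega) h)

theorem sum_mul_pow_lt {p : ℕ} {a : ℕ → ℕ} (K : ℕ) (ha : ∀ l < K, a l < p) :
    ∑ l ∈ Finset.range K, a l * p ^ l < p ^ K := by
  induction K with
  | zero => simp
  | succ K ih =>
    have h1 := ih fun l hl => ha l (by omega)
    have h2 : (a K + 1) * p ^ K ≤ p * p ^ K := Nat.mul_le_mul_right _ (ha K (by omega))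
    rw [Finset.sum_range_succ, pow_succ, mul_comm (p ^ K)]
    rw [add_mul] at h2
    omega

theorem digit_sum_mul_pow {p : ℕ} (hp : 2 ≤ p) {a : ℕ → ℕ} (K : ℕ) (ha : ∀ l < K, a l < p)
    {l : ℕ} (hl : l < K) : digit p (∑ l ∈ Finset.range K, a l * p ^ l) l = a l := by
  induction K with
  | zero => omega
  | succ K ih =>
    have hlt := sum_mul_pow_lt K fun l hl => ha l (by omega)
    rw [Finset.sum_range_succ]
    rcases Nat.lt_succ_iff_lt_or_eq.mp hl with h | h
    · rw [← ih (fun l hl => ha l (by omega)) h]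
      have e : a K * p ^ K = p ^ l * (p * (a K * p ^ (K - l - 1))) := by
        obtain ⟨c, rfl⟩ := Nat.exists_eq_add_of_lt h
        rw [show l + c + 1 - l - 1 = c by omega]
        ring
      unfold digit
      rw [e, Nat.add_mul_div_left _ _ (by positivity), Nat.add_mul_mod_self_left]
    · subst h
      unfold digit
      rw [Nat.add_mul_div_right _ _ (by positivity), Nat.div_eq_of_lt hlt, zero_add,
        Nat.mod_eq_of_lt (ha l hl)]

theorem Digitwise.le {p : ℕ} (hp : 2 ≤ p) {m k : ℕ} (h : Digitwise p m k) : m ≤ k := by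
  calc m = _ := (sum_digit_mul_pow_of_le hp (le_max_left m k)).symm
    _ ≤ _ := ?_
    _ = k := sum_digit_mul_pow_of_le hp (le_max_right m k)
  exact Finset.sum_le_sum fun l _ => Nat.mul_le_mul_right _ (h l)

/-- Lucas' theorem: the digitwise order tells which binomial coefficients survive modulo `p`. -/
theorem not_dvd_choose_iff {p : ℕ} (hp : p.Prime) (k m : ℕ) :
    ¬ p ∣ k.choose m ↔ Digitwise p m k := by
  have : Fact p.Prime := ⟨hp⟩
  obtain ⟨a, hk, hm⟩ : ∃ a, k < p ^ a ∧ m < p ^ a :=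
    ⟨max k m, (Nat.lt_pow_self hp.one_lt).trans_le (Nat.pow_le_pow_right hp.pos (le_max_left _ _)),
      (Nat.lt_pow_self hp.one_lt).trans_le (Nat.pow_le_pow_right hp.pos (le_max_right _ _))⟩
  have h1 := Choose.choose_modEq_prod_range_choose_nat (p := p) hk hm
  have hdig : ∀ x y : ℕ, x < p → (¬ p ∣ x.choose y ↔ y ≤ x) := by
    intro x y hx
    constructor
    · intro h
      by_contra! hlt
      exact h (by simp [Nat.choose_eq_zero_of_lt hlt])
    · intro h hd
      have h2 : p ∣ x.factorial := by
        rw [← Nat.choose_mul_factorial_mul_factorial h, mul_assoc]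
        exact hd.mul_right _
      exact absurd ((hp.dvd_factorial).mp h2) (by omega)
  rw [Nat.ModEq.dvd_iff h1 dvd_rfl, hp.prime.dvd_finsetProd_iff]
  push Not
  constructor
  · intro h l
    by_cases hl : l < a
    · exact (hdig _ _ (Nat.mod_lt _ hp.pos)).mp (h l (Finset.mem_range.mpr hl))
    · rw [digit_eq_zero (hm.trans_le (Nat.pow_le_pow_right hp.pos (by omega)))]
      exact Nat.zero_le _
  · intro h l _
    exact (hdig _ _ (Nat.mod_lt _ hp.pos)).mpr (h l)

/-! ### The token system of a number -/

/-- The sum of the digits of `k` at the positions `< K` that are congruent to `t` modulo `f`. -/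
def digitSum (p : ℕ) {f : ℕ} (k : ℕ) (t : ZMod f) (K : ℕ) : ℕ :=
  ∑ l ∈ Finset.range K, if (l : ZMod f) = t then digit p k l else 0

theorem digitSum_succ (p : ℕ) {f : ℕ} (k : ℕ) (t : ZMod f) (K : ℕ) : digitSum p k t (K + 1)
    = digitSum p k t K + if (K : ZMod f) = t then digit p k K else 0 :=
  Finset.sum_range_succ _ _

theorem digitSum_mono (p : ℕ) {f : ℕ} (k : ℕ) (t : ZMod f) : Monotone (digitSum p k t) :=
  monotone_nat_of_le_succ fun K => by rw [digitSum_succ]; omega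

theorem digitSum_eq_of_le {p : ℕ} (hp : 2 ≤ p) {f : ℕ} {k K : ℕ} (h : k ≤ K) (t : ZMod f) :
    digitSum p k t K = digitSum p k t k := by
  induction K, h using Nat.le_induction with
  | base => rfl
  | succ K hK ih => rw [digitSum_succ, ih, digit_eq_zero_of_le hp hK, ite_self, add_zero]

theorem digitSum_le_of_digitwise {p : ℕ} {f : ℕ} {m k : ℕ} (h : Digitwise p m k) (t : ZMod f)
    (K : ℕ) : digitSum p m t K ≤ digitSum p k t K := by
  refine Finset.sum_le_sum fun l _ => ?_
  split_ifs
  · exact h l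
  · exact le_rfl

/-- The level of the `r`-th token of type `t` of the number `k`. -/
noncomputable def digitLevel (p : ℕ) {f : ℕ} (k : ℕ) (t : ZMod f) (r : ℕ) : ℕ :=
  sInf {l | r < digitSum p k t (l + 1)}

theorem digitLevel_spec {p : ℕ} {f : ℕ} {k : ℕ} {t : ZMod f} {r K : ℕ}
    (h : r < digitSum p k t K) : digitLevel p k t r < K ∧
      digitSum p k t (digitLevel p k t r) ≤ r ∧ r < digitSum p k t (digitLevel p k t r + 1) := by
  obtain ⟨K, rfl⟩ : ∃ K', K = K' + 1 := ⟨K - 1, by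
    rcases K with _ | K
    · simp [digitSum] at h
    · rfl⟩
  have hmem : K ∈ {l | r < digitSum p k t (l + 1)} := h
  refine ⟨Nat.lt_succ_of_le (Nat.sInf_le hmem), ?_, Nat.sInf_mem ⟨K, hmem⟩⟩
  by_contra! hcon
  rcases h0 : digitLevel p k t r with _ | l
  · rw [h0] at hcon; simp [digitSum] at hcon
  · rw [h0] at hcon
    have := Nat.sInf_le (show l ∈ {l | r < digitSum p k t (l + 1)} from hcon)
    simp only [digitLevel] at h0
    omega

theorem digitLevel_eq {p : ℕ} {f : ℕ} {k : ℕ} {t : ZMod f} {r l : ℕ}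
    (h1 : digitSum p k t l ≤ r) (h2 : r < digitSum p k t (l + 1)) : digitLevel p k t r = l := by
  obtain ⟨h3, h4, h5⟩ := digitLevel_spec h2
  refine le_antisymm (by omega) ?_
  by_contra! hlt
  have := digitSum_mono p k t (show digitLevel p k t r + 1 ≤ l by omega)
  omega

/-- The token system of `k`, with the offset given by the digits of `k` modulo `p ^ f - 1`. -/
noncomputable def tokens (p f : ℕ) (hp : 2 ≤ p) (k : ℕ) : TokenSystem p f where
  n t := digitSum p k t k
  lev := digitLevel p k
  offset t := digit p (k % (p ^ f - 1)) t.val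
  offset_nonneg t := by positivity
  lev_mono t r r' h h' := by
    obtain ⟨-, h1, h2⟩ := digitLevel_spec (h.trans_lt h')
    obtain ⟨-, h3, h4⟩ := digitLevel_spec h'
    by_contra! hlt
    have := digitSum_mono p k t (show digitLevel p k t r' + 1 ≤ digitLevel p k t r by omega)
    omega
  lev_cast t r h := by
    obtain ⟨-, h1, h2⟩ := digitLevel_spec h
    by_contra hne
    rw [digitSum_succ, if_neg hne] at h2
    omega
  lev_gap t r h := by
    obtain ⟨-, h1, h2⟩ := digitLevel_spec (show r < digitSum p k t k by omega)
    obtain ⟨-, h3, h4⟩ := digitLevel_spec h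
    by_contra! hle
    have h5 := digitSum_mono p k t (show digitLevel p k t (r + (p - 1)) + 1
      ≤ digitLevel p k t r + 1 by omega)
    have h6 := digitSum_succ p k t (digitLevel p k t r)
    have h7 := digit_lt hp k (digitLevel p k t r)
    split_ifs at h6 <;> omega

theorem sum_pow_digitLevel (p : ℕ) {f : ℕ} (k : ℕ) (t : ZMod f) (c K : ℕ) :
    ∑ r ∈ Finset.range (min c (digitSum p k t K)), p ^ digitLevel p k t r =
      ∑ l ∈ Finset.range K,
        (min c (digitSum p k t (l + 1)) - min c (digitSum p k t l)) * p ^ l := by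
  induction K with
  | zero => simp [digitSum]
  | succ K ih =>
    have hle := digitSum_mono p k t (Nat.le_add_right K 1)
    rw [Finset.sum_range_succ, ← ih, Finset.range_eq_Ico, Finset.range_eq_Ico,
      ← Finset.sum_Ico_consecutive _ (Nat.zero_le (min c (digitSum p k t K))) (by omega)]
    congr 1
    rw [Finset.sum_congr rfl (g := fun _ => p ^ K), Finset.sum_const, Nat.card_Ico, smul_eq_mul]
    intro r hr
    rw [Finset.mem_Ico] at hr
    rw [digitLevel_eq (l := K) (by omega) (by omega)]

/-- The digits of the number formed by the `c t` lowest tokens of every type `t`. -/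
def digitOf (p : ℕ) {f : ℕ} (k : ℕ) (c : ZMod f → ℤ) (l : ℕ) : ℕ :=
  min (c l).toNat (digitSum p k (l : ZMod f) (l + 1))
    - min (c l).toNat (digitSum p k (l : ZMod f) l)

theorem digitOf_le (p : ℕ) {f : ℕ} (k : ℕ) (c : ZMod f → ℤ) (l : ℕ) :
    digitOf p k c l ≤ digit p k l := by
  have := digitSum_succ p k (l : ZMod f) l
  rw [if_pos rfl] at this
  unfold digitOf
  omega

theorem digitOf_mono (p : ℕ) {f : ℕ} (k : ℕ) {c c' : ZMod f → ℤ} (h : ∀ t, c t ≤ c' t) (l : ℕ) :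
    digitOf p k c l ≤ digitOf p k c' l := by
  have := digitSum_mono p k (l : ZMod f) (Nat.le_add_right l 1)
  have := h l
  unfold digitOf
  omega

theorem tokens_n_le {p f : ℕ} (hp : 2 ≤ p) (k : ℕ) {m : ℕ} (h : Digitwise p m k) (t : ZMod f) :
    (tokens p f hp m).n t ≤ (tokens p f hp k).n t := by
  have := digitSum_le_of_digitwise (f := f) h t k
  rwa [digitSum_eq_of_le hp (h.le hp)] at this

section

variable {p f : ℕ} [NeZero f] (hp : 2 ≤ p) (k : ℕ)

theorem val_tokens {c : ZMod f → ℤ} (hc : ∀ t, c t ≤ (tokens p f hp k).n t) :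
    (tokens p f hp k).val c = ∑ l ∈ Finset.range k, digitOf p k c l * p ^ l := by
  have h1 : (tokens p f hp k).val c = ∑ t : ZMod f, ∑ l ∈ Finset.range k,
      (min (c t).toNat (digitSum p k t (l + 1)) - min (c t).toNat (digitSum p k t l)) * p ^ l := by
    refine Finset.sum_congr rfl fun t _ => ?_
    rw [← sum_pow_digitLevel, min_eq_left (by have := hc t; simp only [tokens] at this; omega)]
    rfl
  rw [h1, Finset.sum_comm]
  refine Finset.sum_congr rfl fun l _ => ?_
  rw [Finset.sum_eq_single (l : ZMod f)]
  · rfl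
  · intro t _ ht
    rw [digitSum_succ, if_neg (Ne.symm ht), add_zero, Nat.sub_self, zero_mul]
  · intro h; exact absurd (Finset.mem_univ _) h

theorem digit_val_tokens {c : ZMod f → ℤ} (hc : ∀ t, c t ≤ (tokens p f hp k).n t) (l : ℕ) :
    digit p ((tokens p f hp k).val c) l = if l < k then digitOf p k c l else 0 := by
  have ha : ∀ l < k, digitOf p k c l < p :=
    fun l _ => (digitOf_le p k c l).trans_lt (digit_lt hp k l)
  rw [val_tokens hp k hc]
  split_ifs with h
  · exact digit_sum_mul_pow hp k ha h
  · exact digit_eq_zero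
      ((sum_mul_pow_lt k ha).trans_le (Nat.pow_le_pow_right (by omega) (by omega)))

theorem val_tokens_digitwise {c c' : ZMod f → ℤ} (hc : ∀ t, c t ≤ (tokens p f hp k).n t)
    (hc' : ∀ t, c' t ≤ (tokens p f hp k).n t) (h : ∀ t, c t ≤ c' t) :
    Digitwise p ((tokens p f hp k).val c) ((tokens p f hp k).val c') := by
  intro l
  rw [digit_val_tokens hp k hc, digit_val_tokens hp k hc']
  split_ifs
  · exact digitOf_mono p k h l
  · exact le_rfl

theorem val_tokens_self : (tokens p f hp k).val (fun t => (tokens p f hp k).n t) = k := by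
  rw [val_tokens hp k fun t => le_rfl]
  conv_rhs => rw [← sum_digit_mul_pow_of_le hp le_rfl (k := k)]
  refine Finset.sum_congr rfl fun l hl => ?_
  have hl := Finset.mem_range.mp hl
  congr 1
  have h1 := digitSum_mono p k (l : ZMod f) (show l + 1 ≤ k by omega)
  have h2 := digitSum_succ p k (l : ZMod f) l
  rw [if_pos rfl] at h2
  simp only [digitOf, tokens, Int.toNat_natCast]
  omega

/-- Replacing the tokens of `m` by the lowest tokens of `k` of the same types does not increase the
value. -/
theorem val_tokens_le {m : ℕ} (h : Digitwise p m k) :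
    (tokens p f hp k).val (fun t => (tokens p f hp m).n t) ≤ m := by
  conv_rhs => rw [← val_tokens_self (f := f) hp m]
  refine Finset.sum_le_sum fun t _ => Finset.sum_le_sum fun r hr => ?_
  simp only [tokens, Int.toNat_natCast, Finset.mem_range] at hr
  refine Nat.pow_le_pow_right (by omega) (Nat.sInf_le ?_)
  exact (digitLevel_spec hr).2.2.trans_le (digitSum_le_of_digitwise h t _)

end


/-! ### Numbers as feasible vectors -/

theorem uncarry_sub (p : ℕ) {f : ℕ} (x y : ZMod f → ℤ) (t : ZMod f) :
    uncarry p (x - y) t = uncarry p x t - uncarry p y t := by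
  simp only [uncarry, Pi.sub_apply, mul_sub, Finset.sum_sub_distrib]

theorem uncarry_neg_one (p : ℕ) {f : ℕ} [NeZero f] (c : ZMod f → ℤ) :
    uncarry p c (-1) = ∑ t, (p : ℤ) ^ t.val * c t := by
  rw [sum_zmod_eq_sum_range _ 0, uncarry]
  refine Finset.sum_congr rfl fun i hi => ?_
  rw [neg_add_cancel, zero_add, ZMod.val_cast_of_lt (Finset.mem_range.mp hi)]

theorem uncarry_pos {p f : ℕ} [NeZero f] (hp : 2 ≤ p) {c : ZMod f → ℤ} (hc : ∀ t, 0 ≤ c t)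
    (h : ∃ t, c t ≠ 0) (t : ZMod f) : 0 < uncarry p c t := by
  obtain ⟨s, hs⟩ := h
  refine Finset.sum_pos' (fun i _ => mul_nonneg (by positivity) (hc _))
    ⟨(s - (t + 1)).val, Finset.mem_range.mpr (ZMod.val_lt _), ?_⟩
  rw [ZMod.natCast_zmod_val, add_sub_cancel]
  exact mul_pos (by positivity) (lt_of_le_of_ne (hc s) hs.symm)

theorem one_le_pow_sub_one {p f : ℕ} [NeZero f] (hp : 2 ≤ p) : 1 ≤ p ^ f - 1 := by
  have : 1 < p ^ f := Nat.one_lt_pow (NeZero.ne f) (by omega)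
  omega

theorem cast_pow_sub_one {p f : ℕ} (hp : 2 ≤ p) : ((p ^ f - 1 : ℕ) : ℤ) = (p : ℤ) ^ f - 1 := by
  rw [Nat.cast_sub (Nat.one_le_pow _ _ (by omega))]; push_cast; rfl

/-- Induction along the cycle `ℤ/f`, starting from any point. -/
theorem zmod_cycle_induction {f : ℕ} [NeZero f] {Q : ZMod f → Prop} (t₀ : ZMod f) (h0 : Q t₀)
    (h : ∀ t, Q (t - 1) → Q t) (t : ZMod f) : Q t := by
  have hn : ∀ j : ℕ, Q (t₀ + j) := by
    intro j
    induction j with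
    | zero => simpa using h0
    | succ j ih =>
      refine h _ ?_
      have : t₀ + ((j + 1 : ℕ) : ZMod f) - 1 = t₀ + j := by push_cast; ring
      rwa [this]
  have := hn (t - t₀).val
  rwa [ZMod.natCast_zmod_val, add_sub_cancel] at this

/-- The image of `carry` is cut out by a single congruence. -/
theorem exists_carry_eq {p f : ℕ} [NeZero f] (hp : 2 ≤ p) (c : ZMod f → ℤ)
    (h : (p : ℤ) ^ f - 1 ∣ uncarry p c (-1)) : ∃ y, carry p y = c := by
  have hq : (p : ℤ) ^ f - 1 ≠ 0 := by
    rw [← cast_pow_sub_one hp]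
    have := one_le_pow_sub_one (f := f) hp
    omega
  have hall : ∀ t, (p : ℤ) ^ f - 1 ∣ uncarry p c t := by
    intro t
    have hcop : IsCoprime ((p : ℤ) ^ f - 1) p := by
      refine ⟨-1, (p : ℤ) ^ (f - 1), ?_⟩
      have : (p : ℤ) ^ f = p ^ (f - 1) * p := by
        rw [← pow_succ]; congr 1; have := NeZero.pos f; omega
      rw [this]; ring
    refine zmod_cycle_induction (Q := fun t => (p : ℤ) ^ f - 1 ∣ uncarry p c t) (-1) h
      (fun t ht => ?_) t
    rw [uncarry_pred] at ht
    exact hcop.dvd_of_dvd_mul_left ((dvd_sub_left (dvd_mul_right _ _)).mp ht)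
  choose y hy using hall
  refine ⟨y, funext fun t => mul_left_cancel₀ hq ?_⟩
  have h1 := uncarry_pred p c t
  rw [hy, hy t] at h1
  simp only [carry]
  linear_combination -h1

theorem pow_modEq_of_natCast_eq {p f : ℕ} {l : ℕ} {t : ZMod f}
    (h : (l : ZMod f) = t) : (p : ℤ) ^ l ≡ p ^ t.val [ZMOD p ^ f - 1] := by
  have h1 : (p : ℤ) ^ f ≡ 1 [ZMOD p ^ f - 1] := (Int.modEq_iff_dvd.mpr (by simp)).symm
  rw [← h, ZMod.val_natCast]
  conv_lhs => rw [← Nat.div_add_mod l f, pow_add, pow_mul]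
  simpa using (h1.pow (l / f)).mul_right ((p : ℤ) ^ (l % f))

theorem TokenSystem.val_modEq {p f : ℕ} [NeZero f] (T : TokenSystem p f)
    {c : ZMod f → ℤ} (hc : ∀ t, 0 ≤ c t ∧ c t ≤ T.n t) :
    (T.val c : ℤ) ≡ uncarry p c (-1) [ZMOD p ^ f - 1] := by
  rw [uncarry_neg_one, val]
  push_cast
  refine Int.ModEq.sum fun t _ => ?_
  have h1 : (p : ℤ) ^ t.val * c t = ∑ r ∈ Finset.range (c t).toNat, (p : ℤ) ^ t.val := by
    rw [Finset.sum_const, Finset.card_range, nsmul_eq_mul, Int.toNat_of_nonneg (hc t).1, mul_comm]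
  rw [h1]
  refine Int.ModEq.sum fun r hr => pow_modEq_of_natCast_eq (T.lev_cast t r ?_)
  have := hc t
  have := Finset.mem_range.mp hr
  omega

section

variable {p f : ℕ} [NeZero f] (hp : 2 ≤ p) (k : ℕ)

theorem uncarry_offset : uncarry p (tokens p f hp k).offset (-1) = (k % (p ^ f - 1) : ℕ) := by
  have h := sum_digit_mul_pow p (k % (p ^ f - 1)) f
  have hlt : k % (p ^ f - 1) < p ^ f := by
    have := Nat.mod_lt k (one_le_pow_sub_one (f := f) hp)
    omega
  rw [Nat.mod_eq_of_lt hlt] at h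
  conv_rhs => rw [← h]
  rw [uncarry]
  push_cast
  refine Finset.sum_congr rfl fun i hi => ?_
  rw [neg_add_cancel, zero_add]
  simp only [tokens]
  rw [ZMod.val_cast_of_lt (Finset.mem_range.mp hi), mul_comm]

theorem uncarry_offset_lt (t : ZMod f) :
    uncarry p (tokens p f hp k).offset t < (p : ℤ) ^ f - 1 := by
  have hq := cast_pow_sub_one (f := f) hp
  have hq1 := one_le_pow_sub_one (f := f) hp
  refine zmod_cycle_induction
    (Q := fun t => uncarry p (tokens p f hp k).offset t < (p : ℤ) ^ f - 1)
    (-1) ?_ (fun t ht => ?_) t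
  · rw [uncarry_offset, ← hq]
    exact_mod_cast Nat.mod_lt k hq1
  · rw [uncarry_pred] at ht
    have h1 : (tokens p f hp k).offset t ≤ p - 1 := by
      have := digit_lt hp (k % (p ^ f - 1)) t.val
      simp only [tokens]; omega
    have h2 : ((p : ℤ) ^ f - 1) * (tokens p f hp k).offset t ≤ (p ^ f - 1) * (p - 1) :=
      mul_le_mul_of_nonneg_left h1 (by omega)
    refine lt_of_mul_lt_mul_left (a := (p : ℤ)) ?_ (by positivity)
    linarith

/-- The numbers below `k` in the digitwise order and congruent to `k` modulo `p ^ f - 1` come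
from feasible vectors for the token system of `k`. -/
theorem exists_vector {m : ℕ} (hm : Digitwise p m k) (hmod : m ≡ k [MOD p ^ f - 1]) :
    ∃ y : ZMod f → ℤ, (∀ t, (tokens p f hp k).cnt y t = (tokens p f hp m).n t) ∧
      (tokens p f hp k).Feasible y ∧ (tokens p f hp k).cost y ≤ m ∧
      ∀ t, ((p : ℤ) ^ f - 1) * y t = uncarry p (fun t => ((tokens p f hp m).n t : ℤ)) t
        - uncarry p (tokens p f hp k).offset t := by
  have hq := cast_pow_sub_one (f := f) hp
  obtain ⟨y, hy⟩ := exists_carry_eq hp ((fun t => ((tokens p f hp m).n t : ℤ))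
    - (tokens p f hp k).offset) (by
      rw [uncarry_sub, uncarry_offset]
      have h1 := (tokens p f hp m).val_modEq (c := fun t => ((tokens p f hp m).n t : ℤ))
        (fun t => ⟨by positivity, le_rfl⟩)
      rw [val_tokens_self hp m] at h1
      have h2 : ((k % (p ^ f - 1) : ℕ) : ℤ) ≡ m [ZMOD p ^ f - 1] := by
        rw [← hq, Int.natCast_modEq_iff]
        exact (Nat.mod_modEq k _).trans hmod.symm
      exact (h2.trans h1).dvd)
  have hcnt : ∀ t, (tokens p f hp k).cnt y t = (tokens p f hp m).n t := by
    intro t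
    simp only [TokenSystem.cnt, hy, Pi.sub_apply]; ring
  refine ⟨y, hcnt, fun t => ?_, ?_, fun t => ?_⟩
  · rw [hcnt]
    exact ⟨by positivity, by exact_mod_cast tokens_n_le hp k hm t⟩
  · rw [TokenSystem.cost, funext hcnt]
    exact val_tokens_le hp k hm
  · rw [← uncarry_carry, hy, uncarry_sub]

theorem nonneg_of_mul_eq {q a b y : ℤ} (hq : 0 < q) (h : q * y = a - b) (ha : 0 ≤ a)
    (hb : b < q) : 0 ≤ y := by
  by_contra! hy
  have : q * y ≤ q * (-1) := mul_le_mul_of_nonneg_left (by omega) hq.le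
  linarith

/-- A chain of numbers below `k` in the digitwise order, all congruent to `k` modulo
`p ^ f - 1`, decreasing strictly. -/
structure NumChain (p f k d : ℕ) (m : ℕ → ℕ) : Prop where
  digitwise : ∀ i < d, Digitwise p (m i) k
  modEq : ∀ i < d, m i ≡ k [MOD p ^ f - 1]
  step : ∀ i, i + 1 < d → Digitwise p (m (i + 1)) (m i)
  lt : ∀ i, i + 1 < d → m (i + 1) < m i

theorem NumChain.exists_chain {k d : ℕ} {m : ℕ → ℕ} (hm : NumChain p f k d m) :
    ∃ y, (tokens p f hp k).Chain d y ∧ ∀ i < d, (tokens p f hp k).cost (y i) ≤ m i := by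
  have hq := cast_pow_sub_one (f := f) hp
  have hq1 := one_le_pow_sub_one (f := f) hp
  have : ∀ i, ∃ y : ZMod f → ℤ, i < d →
      (∀ t, (tokens p f hp k).cnt y t = (tokens p f hp (m i)).n t) ∧
      (tokens p f hp k).Feasible y ∧ (tokens p f hp k).cost y ≤ m i ∧
      ∀ t, ((p : ℤ) ^ f - 1) * y t = uncarry p (fun t => ((tokens p f hp (m i)).n t : ℤ)) t
        - uncarry p (tokens p f hp k).offset t := by
    intro i
    by_cases h : i < d
    · obtain ⟨y, hy⟩ := exists_vector hp k (hm.digitwise i h) (hm.modEq i h)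
      exact ⟨y, fun _ => hy⟩
    · exact ⟨0, fun h' => absurd h' h⟩
  choose y hy using this
  refine ⟨y, ⟨fun i hi => (hy i hi).2.1, fun i hi t => ?_, fun i hi t => ?_⟩,
    fun i hi => (hy i hi).2.2.1⟩
  · refine nonneg_of_mul_eq (by omega) ((hy i hi).2.2.2 t) ?_ (uncarry_offset_lt hp k t)
    exact Finset.sum_nonneg fun i _ => by positivity
  · have h1 := (hy i (by omega)).2.2.2 t
    have h2 := (hy (i + 1) hi).2.2.2 t
    have h3 := uncarry_pos hp (c := (fun t => ((tokens p f hp (m i)).n t : ℤ))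
      - fun t => ((tokens p f hp (m (i + 1))).n t : ℤ)) (fun t => by
        have := tokens_n_le (f := f) hp (m i) (hm.step i hi) t
        simp only [Pi.sub_apply]; omega) (by
        by_contra! hcon
        have h4 := val_tokens_le (f := f) hp (m i) (hm.step i hi)
        have h5 : (fun t : ZMod f => ((tokens p f hp (m (i + 1))).n t : ℤ))
            = fun t => ((tokens p f hp (m i)).n t : ℤ) := by
          funext t
          have := hcon t
          simp only [Pi.sub_apply] at this
          omega
        rw [h5, val_tokens_self] at h4
        have := hm.lt i hi
        omega) t
    rw [uncarry_sub] at h3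
    have h6 : ((p : ℤ) ^ f - 1) * y (i + 1) t < (p ^ f - 1) * y i t := by linarith
    have := lt_of_mul_lt_mul_left h6 (by omega)
    omega

/-- A nested chain of vectors gives a chain of numbers, formed by the lowest tokens of `k`. -/
theorem numChain_of_nested {k d : ℕ} {z : ℕ → ZMod f → ℤ} (hz : (tokens p f hp k).Chain d z)
    (hn : (tokens p f hp k).Nested d z) :
    NumChain p f k d fun i => (tokens p f hp k).cost (z i) := by
  have hq := cast_pow_sub_one (f := f) hp
  refine ⟨fun i hi => ?_, fun i hi => ?_, fun i hi => ?_, fun i hi => ?_⟩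
  · have hF := hz.feasible i hi
    have := val_tokens_digitwise hp k (fun t => (hF t).2) (fun t => le_rfl) (fun t => (hF t).2)
    rwa [val_tokens_self] at this
  · have hF := hz.feasible i hi
    rw [← Int.natCast_modEq_iff, hq]
    have h1 := (tokens p f hp k).val_modEq hF
    have h2 : uncarry p ((tokens p f hp k).cnt (z i)) (-1)
        = uncarry p (tokens p f hp k).offset (-1) + (p ^ f - 1) * z i (-1) := by
      rw [← uncarry_carry, ← sub_eq_iff_eq_add', ← uncarry_sub]
      congr 1
      funext t
      simp only [TokenSystem.cnt, Pi.sub_apply]; ring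
    rw [h2, uncarry_offset] at h1
    have h3 : ((k % (p ^ f - 1) : ℕ) : ℤ) + (p ^ f - 1) * z i (-1)
        ≡ (k % (p ^ f - 1) : ℕ) + 0 [ZMOD p ^ f - 1] :=
      Int.ModEq.add_left _ (Int.modEq_zero_iff_dvd.mpr (dvd_mul_right _ _))
    rw [add_zero] at h3
    refine (h1.trans h3).trans ?_
    rw [← hq, Int.natCast_modEq_iff]
    exact Nat.mod_modEq k _
  · exact val_tokens_digitwise hp k (fun t => (hz.feasible _ hi t).2)
      (fun t => (hz.feasible i (by omega) t).2) (hn i hi)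
  · have hne : z (i + 1) ≠ z i := fun h => by
      have := hz.strict i hi 0
      rw [h] at this
      omega
    obtain ⟨t, ht⟩ := Function.ne_iff.mp fun h => hne ((tokens p f hp k).cnt_injective hp h)
    have h1 := hn i hi t
    have h0 := hz.feasible _ hi t
    have h2 := (tokens p f hp k).pow_le_gain (c := (tokens p f hp k).cnt (z (i + 1)))
      (c' := (tokens p f hp k).cnt (z i)) t _ le_rfl (by omega)
    have h3 := (tokens p f hp k).val_add_gain ((tokens p f hp k).cnt (z (i + 1)))
      ((tokens p f hp k).cnt (z i))
    have h4 : (tokens p f hp k).gain ((tokens p f hp k).cnt (z i))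
        ((tokens p f hp k).cnt (z (i + 1))) = 0 := by
      refine Finset.sum_eq_zero fun t _ => ?_
      rw [Finset.Ico_eq_empty_of_le, Finset.sum_empty]
      have := hn i hi t
      omega
    have h5 : 0 < p ^ (tokens p f hp k).lev t ((tokens p f hp k).cnt (z (i + 1)) t).toNat := by
      positivity
    simp only [TokenSystem.cost]
    omega

end

/-! ### Cheapest chains of numbers -/

/-- In a cheapest chain the first number is as small as it can be in any chain of that length. -/
theorem NumChain.exists_sum_lt {p f : ℕ} [NeZero f] (hp : 2 ≤ p) {k d : ℕ} {m m' : ℕ → ℕ}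
    (hm : NumChain p f k (d + 1) m) (hm' : NumChain p f k (d + 1) m') (hlt : m' 0 < m 0) :
    ∃ o, NumChain p f k (d + 1) o ∧
      ∑ i ∈ Finset.range (d + 1), o i < ∑ i ∈ Finset.range (d + 1), m i := by
  obtain ⟨y, hy, hyc⟩ := hm.exists_chain hp
  obtain ⟨y', hy', hyc'⟩ := hm'.exists_chain hp
  have hle : ∑ i ∈ Finset.range (d + 1), (tokens p f hp k).cost (y i)
      ≤ ∑ i ∈ Finset.range (d + 1), m i :=
    Finset.sum_le_sum fun i hi => hyc i (Finset.mem_range.mp hi)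
  have h0 := hyc 0 (by omega)
  have h0' := hyc' 0 (by omega)
  obtain ⟨x, hx, hxs⟩ : ∃ x, (tokens p f hp k).Chain (d + 1) x ∧
      ∑ i ∈ Finset.range (d + 1), (tokens p f hp k).cost (x i)
        < ∑ i ∈ Finset.range (d + 1), m i := by
    rcases h0.lt_or_eq with h | h
    · exact ⟨y, hy, Finset.sum_lt_sum (fun i hi => hyc i (Finset.mem_range.mp hi))
        ⟨0, Finset.mem_range.mpr (by omega), h⟩⟩
    · obtain ⟨x, hx, hxs⟩ := hy.exists_cheaper hp (hy'.feasible 0 (by omega))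
        (hy'.le_apply d 0 (by omega)) (by omega)
      exact ⟨x, hx, by omega⟩
  obtain ⟨z, hz, hzn, hzs⟩ := hx.exists_nested hp
  exact ⟨_, numChain_of_nested hp hz hzn, by omega⟩

/-- Prepending a number to a sequence. -/
def seqCons (j : ℕ) (m : ℕ → ℕ) : ℕ → ℕ
  | 0 => j
  | i + 1 => m i

theorem sum_seqCons (j : ℕ) (m : ℕ → ℕ) (d : ℕ) :
    ∑ i ∈ Finset.range (d + 1), seqCons j m i = j + ∑ i ∈ Finset.range d, m i := by
  rw [Finset.sum_range_succ', add_comm]; rfl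

theorem NumChain.tail {p f k d : ℕ} {m : ℕ → ℕ} (hm : NumChain p f k (d + 1) m) :
    NumChain p f k d fun i => m (i + 1) :=
  ⟨fun i hi => hm.digitwise _ (by omega), fun i hi => hm.modEq _ (by omega),
    fun i hi => hm.step _ (by omega), fun i hi => hm.lt _ (by omega)⟩

theorem NumChain.digitwise_zero {p f k d : ℕ} {m : ℕ → ℕ} (hm : NumChain p f k d m) :
    ∀ i < d, Digitwise p (m i) (m 0) := by
  intro i
  induction i with
  | zero => intro _ l; exact le_rfl
  | succ i ih => intro hi; exact (hm.step i hi).trans (ih (by omega))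

theorem NumChain.tail_head {p f k d : ℕ} {m : ℕ → ℕ} (hm : NumChain p f k (d + 1) m) :
    NumChain p f (m 0) d fun i => m (i + 1) :=
  ⟨fun i hi => hm.digitwise_zero _ (by omega),
    fun i hi => (hm.modEq _ (by omega)).trans (hm.modEq 0 (by omega)).symm,
    fun i hi => hm.step _ (by omega), fun i hi => hm.lt _ (by omega)⟩

theorem NumChain.cons {p f k d j : ℕ} {m : ℕ → ℕ} (hm : NumChain p f j d m)
    (hj : Digitwise p j k) (hjk : j ≡ k [MOD p ^ f - 1]) (hlt : 0 < d → m 0 < j) :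
    NumChain p f k (d + 1) (seqCons j m) := by
  refine ⟨fun i hi => ?_, fun i hi => ?_, fun i hi => ?_, fun i hi => ?_⟩
  · rcases i with _ | i
    · exact hj
    · exact (hm.digitwise i (by omega)).trans hj
  · rcases i with _ | i
    · exact hjk
    · exact (hm.modEq i (by omega)).trans hjk
  · rcases i with _ | i
    · exact hm.digitwise 0 (by omega)
    · exact hm.step i (by omega)
  · rcases i with _ | i
    · exact hlt (by omega)
    · exact hm.lt i (by omega)

/-- A chain of length `d` with the least possible sum. -/
def IsMinChain (p f k d : ℕ) (m : ℕ → ℕ) : Prop :=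
  NumChain p f k d m ∧ ∀ m', NumChain p f k d m' →
    ∑ i ∈ Finset.range d, m i ≤ ∑ i ∈ Finset.range d, m' i

theorem exists_isMinChain {p f k d : ℕ} (h : ∃ m, NumChain p f k d m) :
    ∃ m, IsMinChain p f k d m := by
  obtain ⟨x, hx, hmin⟩ :=
    (measure fun m : ℕ → ℕ => ∑ i ∈ Finset.range d, m i).wf.has_min {m | NumChain p f k d m} h
  exact ⟨x, hx, fun y hy => not_lt.mp (hmin y hy)⟩

theorem IsMinChain.head_le {p f : ℕ} [NeZero f] (hp : 2 ≤ p) {k d : ℕ} {m m' : ℕ → ℕ}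
    (hm : IsMinChain p f k (d + 1) m) (hm' : NumChain p f k (d + 1) m') : m 0 ≤ m' 0 := by
  by_contra! hlt
  obtain ⟨o, ho, hlt⟩ := hm.1.exists_sum_lt hp hm' hlt
  have := hm.2 o ho
  omega

/-- There is at most one chain with the least possible sum. -/
theorem IsMinChain.unique {p f : ℕ} [NeZero f] (hp : 2 ≤ p) {k d : ℕ} {m m' : ℕ → ℕ}
    (hm : IsMinChain p f k d m) (hm' : IsMinChain p f k d m') : ∀ i < d, m i = m' i := by
  induction d generalizing k m m' with
  | zero => intro i hi; omega
  | succ d ih =>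
    have tail_min : ∀ {n : ℕ → ℕ}, IsMinChain p f k (d + 1) n →
        IsMinChain p f (n 0) d fun i => n (i + 1) := by
      intro n hn
      refine ⟨hn.1.tail_head, fun x hx => ?_⟩
      obtain ⟨o, ho⟩ := exists_isMinChain ⟨_, hn.1.tail_head⟩
      have hcons := ho.1.cons (hn.1.digitwise 0 (by omega)) (hn.1.modEq 0 (by omega))
        (fun hd => by
          obtain ⟨d, rfl⟩ : ∃ d', d = d' + 1 := ⟨d - 1, by omega⟩
          have h1 := ho.head_le hp hn.1.tail_head
          have h2 := hn.1.lt 0 (by omega)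
          simp only [zero_add] at h1 h2
          omega)
      have h1 := hn.2 _ hcons
      have h2 := ho.2 x hx
      rw [sum_seqCons, Finset.sum_range_succ'] at h1
      simp only
      omega
    have h0 : m 0 = m' 0 := le_antisymm (hm.head_le hp hm'.1) (hm'.head_le hp hm.1)
    have ht := tail_min hm
    rw [h0] at ht
    have := ih ht (tail_min hm')
    intro i hi
    rcases i with _ | i
    · exact h0
    · exact this i (by omega)

/-- Chains of length `d + 1` below `k` exist if and only if the cyclic shifts of the digits of `k`
have large enough sums. -/
theorem exists_numChain_iff {p f : ℕ} [NeZero f] (hp : 2 ≤ p) (k d : ℕ) :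
    (∃ m, NumChain p f k (d + 1) m) ↔
      ∀ t, (d : ℤ) * (p ^ f - 1) ≤ uncarry p (fun t : ZMod f => ((tokens p f hp k).n t : ℤ)) t := by
  have hq := cast_pow_sub_one (f := f) hp
  have hq1 := one_le_pow_sub_one (f := f) hp
  constructor
  · rintro ⟨m, hm⟩ t
    obtain ⟨y, hy, -⟩ := hm.exists_chain hp
    have h1 := hy.le_apply d 0 (by omega) t
    have h2 := uncarry_carry p (y 0) t
    have h3 : uncarry p (carry p (y 0)) t
        ≤ uncarry p (fun t : ZMod f => ((tokens p f hp k).n t : ℤ)) t := by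
      refine Finset.sum_le_sum fun i _ => mul_le_mul_of_nonneg_left ?_ (by positivity)
      have h4 := hy.feasible 0 (by omega) (t + 1 + i)
      have h5 := (tokens p f hp k).offset_nonneg (t + 1 + i)
      simp only [TokenSystem.cnt] at h4 ⊢
      omega
    have h4 : ((p : ℤ) ^ f - 1) * d ≤ (p ^ f - 1) * y 0 t :=
      mul_le_mul_of_nonneg_left h1 (by omega)
    linarith
  · intro h
    obtain ⟨x, hxc, hx, -, hxq⟩ := exists_vector (f := f) hp k (fun l => le_rfl) (Nat.ModEq.refl k)
    have hxd : ∀ t, (d : ℤ) ≤ x t := by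
      intro t
      have h1 := uncarry_offset_lt hp k t
      have h2 := h t
      have := nonneg_of_mul_eq (y := x t - d) (by omega)
        (a := uncarry p (fun t : ZMod f => ((tokens p f hp k).n t : ℤ)) t - d * (p ^ f - 1))
        (by rw [mul_sub, hxq t]; ring) (by linarith) h1
      omega
    have step : ∀ (i : ℕ) (x : ZMod f → ℤ), ∃ z, i < d → (tokens p f hp k).Feasible x →
        (∀ t, (d : ℤ) - i ≤ x t) → (tokens p f hp k).Feasible z ∧ (∀ t, z t + 1 ≤ x t) ∧
        (∀ t, (d : ℤ) - (i + 1 : ℕ) ≤ z t) ∧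
        ∀ t, (tokens p f hp k).cnt z t ≤ (tokens p f hp k).cnt x t := by
      intro i x
      by_cases h : i < d ∧ (tokens p f hp k).Feasible x ∧ ∀ t, (d : ℤ) - i ≤ x t
      · obtain ⟨z, hz⟩ := (tokens p f hp k).exists_feasible_lt (by omega) h.2.1
          (N := (d : ℤ) - (i + 1 : ℕ)) (by push_cast; omega)
          (fun t => by have := h.2.2 t; push_cast; omega)
        exact ⟨z, fun _ _ _ => hz⟩
      · exact ⟨0, fun h1 h2 h3 => absurd ⟨h1, h2, h3⟩ h⟩
    choose g hg using step
    set v : ℕ → ZMod f → ℤ := fun i => Nat.rec x g i with hv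
    have hvs : ∀ i, v (i + 1) = g i (v i) := fun i => rfl
    have hgood : ∀ i, i ≤ d → (tokens p f hp k).Feasible (v i) ∧ ∀ t, (d : ℤ) - i ≤ v i t := by
      intro i
      induction i with
      | zero =>
        intro _
        refine ⟨hx, fun t => ?_⟩
        rw [show v 0 = x from rfl]
        simpa using hxd t
      | succ i ih =>
        intro hi
        obtain ⟨h1, h2⟩ := ih (by omega)
        have h3 := hg i (v i) (by omega) h1 h2
        rw [hvs]
        exact ⟨h3.1, h3.2.2.1⟩
    have hnext := fun i (hi : i < d) => hg i (v i) hi (hgood i hi.le).1 (hgood i hi.le).2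
    refine ⟨_, numChain_of_nested hp (d := d + 1) (z := v)
      ⟨fun i hi => (hgood i (by omega)).1, fun i hi t => ?_,
        fun i hi => (hnext i (by omega)).2.1⟩ fun i hi => (hnext i (by omega)).2.2.2⟩
    have := (hgood i (by omega)).2 t
    omega


/-! ### Digit sums in base `p ^ f` -/

theorem digit_mul_pow_add {p : ℕ} (hp : 0 < p) (k i l : ℕ) :
    digit p (k * p ^ i) (i + l) = digit p k l := by
  rw [digit, digit, pow_add, ← Nat.div_div_eq_div_mul, Nat.mul_div_cancel _ (by positivity)]

theorem digit_mul_pow_of_lt {p : ℕ} (hp : 0 < p) (k : ℕ) {i l : ℕ} (h : l < i) :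
    digit p (k * p ^ i) l = 0 := by
  obtain ⟨c, rfl⟩ := Nat.exists_eq_add_of_lt h
  rw [digit, show k * p ^ (l + c + 1) = (p * (k * p ^ c)) * p ^ l by ring,
    Nat.mul_div_cancel _ (by positivity), Nat.mul_mod_right]

theorem digits_sum_eq {p f : ℕ} [NeZero f] (hp : 2 ≤ p) (N : ℕ) : ∀ k < (p ^ f) ^ N,
    ((p ^ f).digits k).sum = ∑ l ∈ Finset.range (f * N), digit p k l * p ^ (l % f) := by
  have hq : 1 < p ^ f := Nat.one_lt_pow (NeZero.ne f) (by omega)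
  induction N with
  | zero => intro k hk; simp at hk; simp [hk]
  | succ N ih =>
    intro k hk
    have h1 : ((p ^ f).digits k).sum = k % p ^ f + ((p ^ f).digits (k / p ^ f)).sum := by
      rcases Nat.eq_zero_or_pos k with h | h
      · simp [h]
      · rw [Nat.digits_def' hq h, List.sum_cons]
    have h2 : k / p ^ f < (p ^ f) ^ N := by
      rw [Nat.div_lt_iff_lt_mul (by omega), ← pow_succ]; exact hk
    rw [h1, ih _ h2, mul_add, mul_one, add_comm (f * N), Finset.sum_range_add,
      ← sum_digit_mul_pow]
    congr 1
    · refine Finset.sum_congr rfl fun l hl => ?_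
      rw [Nat.mod_eq_of_lt (Finset.mem_range.mp hl)]
    · refine Finset.sum_congr rfl fun l _ => ?_
      rw [Nat.add_mod_left, digit, digit, pow_add, Nat.div_div_eq_div_mul]

/-- Multiplication by `p ^ i` shifts the types of the digits cyclically by `i`. -/
theorem digits_sum_mul_pow {p f : ℕ} [NeZero f] (hp : 2 ≤ p) (k i : ℕ) :
    (((p ^ f).digits (k * p ^ i)).sum : ℤ)
      = uncarry p (fun t : ZMod f => ((tokens p f hp k).n t : ℤ)) (-1 - i) := by
  obtain ⟨K, hK, hN⟩ : ∃ K, k ≤ K ∧ i + K = f * (k + i) := by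
    have := Nat.le_mul_of_pos_left (k + i) (NeZero.pos f)
    exact ⟨f * (k + i) - i, by omega, by omega⟩
  have hlt : k * p ^ i < (p ^ f) ^ (k + i) := by
    rw [← pow_mul]
    calc k * p ^ i < p ^ k * p ^ i :=
          Nat.mul_lt_mul_of_pos_right (Nat.lt_pow_self (by omega)) (by positivity)
      _ = p ^ (k + i) := (pow_add _ _ _).symm
      _ ≤ _ := Nat.pow_le_pow_right (by omega) (Nat.le_mul_of_pos_left _ (NeZero.pos f))
  have h1 : ((p ^ f).digits (k * p ^ i)).sum
      = ∑ l ∈ Finset.range K, digit p k l * p ^ ((i + l) % f) := by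
    rw [digits_sum_eq hp _ _ hlt, ← hN, Finset.sum_range_add, Finset.sum_eq_zero, zero_add]
    · exact Finset.sum_congr rfl fun l _ => by rw [digit_mul_pow_add (by omega)]
    · intro l hl
      rw [digit_mul_pow_of_lt (by omega) k (Finset.mem_range.mp hl), zero_mul]
  have h2 : uncarry p (fun t : ZMod f => ((tokens p f hp k).n t : ℤ)) (-1 - i)
      = ∑ t : ZMod f, (p : ℤ) ^ (i + t).val * (tokens p f hp k).n t := by
    rw [sum_zmod_eq_sum_range _ (-(i : ZMod f)), uncarry]
    refine Finset.sum_congr rfl fun j hj => ?_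
    have e1 : (-1 - (i : ZMod f) + 1 + j) = -(i : ZMod f) + j := by ring
    have e2 : ((i : ZMod f) + (-(i : ZMod f) + j)) = j := by ring
    rw [e1, e2, ZMod.val_cast_of_lt (Finset.mem_range.mp hj)]
  have h3 : ∀ t : ZMod f, (p : ℤ) ^ (i + t).val * (tokens p f hp k).n t
      = ∑ l ∈ Finset.range K, if (l : ZMod f) = t then (digit p k l : ℤ) * p ^ ((i + l) % f)
        else 0 := by
    intro t
    have h4 : (tokens p f hp k).n t = digitSum p k t K := (digitSum_eq_of_le hp hK t).symm
    rw [h4, digitSum]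
    push_cast
    rw [Finset.mul_sum]
    refine Finset.sum_congr rfl fun l _ => ?_
    split_ifs with h
    · rw [← h, ← Nat.cast_add, ZMod.val_natCast, mul_comm]
    · rw [mul_zero]
  rw [h2, Finset.sum_congr rfl fun t _ => h3 t, Finset.sum_comm, h1]
  push_cast
  refine Finset.sum_congr rfl fun l _ => ?_
  rw [Finset.sum_ite_eq]
  simp

/-- The bound `L_k` counts the length of the longest chains below `k`. -/
theorem le_L_iff {p f : ℕ} [NeZero f] (hp : 2 ≤ p) (k d : ℕ) :
    (d : ℝ) ≤ L p f k ↔ ∃ m, NumChain p f k (d + 1) m := by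
  have : Nonempty (Fin f) := ⟨⟨0, NeZero.pos f⟩⟩
  have hq := cast_pow_sub_one (f := f) hp
  have hq1 := one_le_pow_sub_one (f := f) hp
  rw [exists_numChain_iff hp, L, le_ciInf_iff (Set.finite_range _).bddBelow]
  have hqr : (0 : ℝ) < ((p ^ f : ℕ) : ℝ) - 1 := by
    have : (1 : ℝ) < ((p ^ f : ℕ) : ℝ) := by exact_mod_cast (by omega : 1 < p ^ f)
    linarith
  have key : ∀ i : ℕ, (d : ℝ) ≤ (((p ^ f).digits (k * p ^ i)).sum : ℝ) / (((p ^ f : ℕ) : ℝ) - 1)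
      ↔ (d : ℤ) * (p ^ f - 1)
        ≤ uncarry p (fun t : ZMod f => ((tokens p f hp k).n t : ℤ)) (-1 - i) := by
    intro i
    rw [le_div_iff₀ hqr, ← digits_sum_mul_pow hp k i]
    have : (d : ℝ) * (((p ^ f : ℕ) : ℝ) - 1) = (((d : ℤ) * (p ^ f - 1) : ℤ) : ℝ) := by
      push_cast; rfl
    rw [this, ← Int.cast_natCast (((p ^ f).digits (k * p ^ i)).sum), Int.cast_le]
  constructor
  · intro h t
    have h1 := (key (-1 - t).val).mp (h ⟨_, ZMod.val_lt _⟩)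
    rwa [ZMod.natCast_zmod_val, sub_sub_cancel] at h1
  · intro h i
    exact (key i).mpr (h _)


/-! ### Power sums of polynomials -/

theorem exists_of_coeff_sum_ne_zero {F : Type*} [Field F] {a : ℕ → F} {S : ℕ → F[X]} {N n : ℕ}
    (h : (∑ j ∈ Finset.range N, C (a j) * (X ^ j * S j)).coeff n ≠ 0) :
    ∃ j < N, a j ≠ 0 ∧ j ≤ n ∧ (S j).coeff (n - j) ≠ 0 := by
  rw [finsetSum_coeff] at h
  obtain ⟨j, hj, hne⟩ := Finset.exists_ne_zero_of_sum_ne_zero h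
  rw [coeff_C_mul, coeff_X_pow_mul'] at hne
  refine ⟨j, Finset.mem_range.mp hj, left_ne_zero_of_mul hne, ?_⟩
  have := right_ne_zero_of_mul hne
  split_ifs at this with hle
  · exact ⟨hle, this⟩
  · exact absurd rfl this

theorem coeff_sum_ne_zero {F : Type*} [Field F] {a : ℕ → F} {S : ℕ → F[X]} {N n j₀ : ℕ}
    (hj₀ : j₀ < N) (hle : j₀ ≤ n) (ha : a j₀ ≠ 0) (hS : (S j₀).coeff (n - j₀) ≠ 0)
    (hother : ∀ j < N, a j ≠ 0 → j ≤ n → (S j).coeff (n - j) ≠ 0 → j = j₀) :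
    (∑ j ∈ Finset.range N, C (a j) * (X ^ j * S j)).coeff n ≠ 0 := by
  rw [finsetSum_coeff, Finset.sum_eq_single j₀]
  · rw [coeff_C_mul, coeff_X_pow_mul', if_pos hle]
    exact mul_ne_zero ha hS
  · intro j hj hne
    rw [coeff_C_mul, coeff_X_pow_mul']
    by_contra hcon
    have h1 := right_ne_zero_of_mul hcon
    split_ifs at h1 with h2
    · exact hne (hother j (Finset.mem_range.mp hj) (left_ne_zero_of_mul hcon) h2 h1)
    · exact h1 rfl
  · intro h; exact absurd (Finset.mem_range.mpr hj₀) h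

section

variable {F : Type*} [Field F] [Fintype F]

theorem mem_monics {d : ℕ} {a : F[X]} : a ∈ monics F d ↔ a.Monic ∧ a.natDegree = d := by
  simp [monics]

theorem monics_zero : monics F 0 = {1} := by
  ext a
  rw [mem_monics, Finset.mem_singleton]
  constructor
  · rintro ⟨h1, h2⟩
    exact h1.natDegree_eq_zero.mp h2
  · rintro rfl
    exact ⟨monic_one, natDegree_one⟩

theorem sum_monics_succ {M : Type*} [AddCommMonoid M] (d : ℕ) (g : F[X] → M) :
    ∑ a ∈ monics F (d + 1), g a = ∑ b ∈ monics F d, ∑ c : F, g (X * b + C c) := by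
  rw [← Finset.sum_product']
  refine Finset.sum_bij' (fun a _ => (a.divX, a.coeff 0)) (fun x _ => X * x.1 + C x.2)
    ?_ ?_ ?_ ?_ ?_
  · intro a ha
    obtain ⟨h1, h2⟩ := mem_monics.mp ha
    simp only [Finset.mem_product, Finset.mem_univ, and_true, mem_monics]
    have h3 : a.divX.natDegree = d := by rw [natDegree_divX_eq_natDegree_tsub_one, h2]; rfl
    refine ⟨?_, h3⟩
    rw [Monic, leadingCoeff, h3, coeff_divX, ← h2]
    exact h1
  · rintro ⟨b, c⟩ hx
    simp only [Finset.mem_product, Finset.mem_univ, and_true, mem_monics] at hx ⊢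
    obtain ⟨h1, h2⟩ := hx
    have h3 : (X * b).natDegree = d + 1 := by rw [natDegree_X_mul h1.ne_zero, h2]
    refine ⟨(monic_X.mul h1).add_of_left (degree_C_le.trans_lt ?_), ?_⟩
    · rw [degree_eq_natDegree (monic_X.mul h1).ne_zero, h3]
      exact_mod_cast Nat.succ_pos d
    · rw [natDegree_add_C, h3]
  · intro a _
    exact X_mul_divX_add a
  · rintro ⟨b, c⟩ _
    have : (X * b + C c).divX = b := by ext n; simp [coeff_divX]
    simp [this]
  · intro a _
    rw [X_mul_divX_add]

/-- The power sum `∑ a ^ k` over the monic polynomials `a` of degree `d`. -/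
noncomputable def powerSum (F : Type*) [Field F] [Finite F] (d k : ℕ) : F[X] :=
  ∑ a ∈ monics F d, a ^ k

open Classical in
/-- The power sum `∑ a ^ k` over the monic polynomials `a` of degree `d` with nonzero constant
term. -/
noncomputable def powerSumPrime (F : Type*) [Field F] [Finite F] (d k : ℕ) : F[X] :=
  ∑ a ∈ (monics F d).filter (fun a => a.coeff 0 ≠ 0), a ^ k

theorem powerSum_zero (k : ℕ) : powerSum F 0 k = 1 := by
  simp [powerSum, monics_zero]

theorem powerSumPrime_zero (k : ℕ) : powerSumPrime F 0 k = 1 := by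
  simp [powerSumPrime, monics_zero, Finset.filter_singleton]

open Classical in
theorem sum_ne_zero_pow (i : ℕ) : ∑ x : F with x ≠ 0, x ^ i
    = if Fintype.card F - 1 ∣ i then -1 else 0 := by
  rw [← FiniteField.sum_pow_units F i]
  refine (Finset.sum_bij (fun (u : Fˣ) _ => (u : F)) ?_ ?_ ?_ ?_).symm
  · intro u _; simp
  · intro u _ w _ h; exact Units.ext h
  · intro x hx
    exact ⟨Units.mk0 x (Finset.mem_filter.mp hx).2, Finset.mem_univ _, rfl⟩
  · intro u _; rfl

theorem sum_pow_of_ne_zero {i : ℕ} (hi : i ≠ 0) : ∑ x : F, x ^ i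
    = if Fintype.card F - 1 ∣ i then -1 else 0 := by
  classical
  rw [← sum_ne_zero_pow, Finset.sum_filter]
  refine Finset.sum_congr rfl fun x _ => ?_
  split_ifs with h
  · rfl
  · rw [not_not.mp h, zero_pow hi]

/-- The coefficient with which `X ^ j * powerSum F d j` enters `powerSum F (d + 1) k` and
`powerSumPrime F (d + 1) k`. -/
noncomputable def recCoeff (F : Type*) [Field F] [Fintype F] (k j : ℕ) : F :=
  if Fintype.card F - 1 ∣ k - j then -(k.choose j : F) else 0

theorem sum_add_C_pow (d k : ℕ) (G : Finset F) :
    ∑ b ∈ monics F d, ∑ c ∈ G, (X * b + C c) ^ k = ∑ j ∈ Finset.range (k + 1),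
      C ((k.choose j : F) * ∑ c ∈ G, c ^ (k - j)) * (X ^ j * powerSum F d j) := by
  have h : ∀ b ∈ monics F d, ∀ c ∈ G, (X * b + C c) ^ k = ∑ j ∈ Finset.range (k + 1),
      C ((k.choose j : F) * c ^ (k - j)) * (X ^ j * b ^ j) := by
    intro b _ c _
    rw [add_pow]
    refine Finset.sum_congr rfl fun j _ => ?_
    rw [mul_pow, C_mul, C_pow, map_natCast]
    ring
  rw [Finset.sum_congr rfl fun b hb => Finset.sum_congr rfl (h b hb)]
  rw [Finset.sum_congr rfl fun b hb => Finset.sum_comm, Finset.sum_comm]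
  refine Finset.sum_congr rfl fun j _ => ?_
  rw [Finset.mul_sum, map_sum, powerSum, Finset.sum_mul, Finset.sum_comm]
  refine Finset.sum_congr rfl fun c _ => ?_
  rw [Finset.mul_sum, Finset.mul_sum]

theorem powerSum_succ (d k : ℕ) : powerSum F (d + 1) k
    = ∑ j ∈ Finset.range k, C (recCoeff F k j) * (X ^ j * powerSum F d j) := by
  rw [powerSum, sum_monics_succ, sum_add_C_pow, Finset.sum_range_succ]
  -- the term `j = k` is lost, as the constant `1` sums to the cardinality of `F`
  have h0 : ∑ c : F, c ^ (k - k) = 0 := by simp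
  rw [h0, mul_zero, C_0, zero_mul, add_zero]
  refine Finset.sum_congr rfl fun j hj => ?_
  have := Finset.mem_range.mp hj
  rw [sum_pow_of_ne_zero (by omega), recCoeff]
  split_ifs <;> simp

/-- Over the nonzero constant terms the constant `1` sums to `-1`, so the term `j = k` persists. -/
theorem powerSumPrime_succ (d k : ℕ) : powerSumPrime F (d + 1) k
    = ∑ j ∈ Finset.range (k + 1), C (recCoeff F k j) * (X ^ j * powerSum F d j) := by
  classical
  have h : powerSumPrime F (d + 1) k
      = ∑ b ∈ monics F d, ∑ c : F with c ≠ 0, (X * b + C c) ^ k := by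
    rw [powerSumPrime, Finset.sum_filter, sum_monics_succ]
    refine Finset.sum_congr rfl fun b _ => ?_
    rw [Finset.sum_filter]
    refine Finset.sum_congr rfl fun c _ => ?_
    simp
  rw [h, sum_add_C_pow]
  refine Finset.sum_congr rfl fun j hj => ?_
  rw [sum_ne_zero_pow, recCoeff]
  split_ifs <;> simp

theorem recCoeff_ne_zero_iff {p f : ℕ} (hp : p.Prime) (hq : Fintype.card F = p ^ f) {k j : ℕ}
    (hj : j ≤ k) : recCoeff F k j ≠ 0 ↔ Digitwise p j k ∧ j ≡ k [MOD p ^ f - 1] := by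
  have : Fact p.Prime := ⟨hp⟩
  have : CharP F p := charP_of_card_eq_prime_pow hq
  rw [recCoeff, hq, ← not_dvd_choose_iff hp, ← CharP.cast_eq_zero_iff F p, Nat.modEq_iff_dvd' hj]
  split_ifs with h <;> simp [h]

theorem exists_numChain_of_coeff_powerSum_ne_zero {p f : ℕ} (hp : p.Prime)
    (hq : Fintype.card F = p ^ f) (d : ℕ) : ∀ k n,
    (powerSum F d k).coeff n ≠ 0 →
      ∃ m, NumChain p f k d m ∧ (0 < d → m 0 < k) ∧ ∑ i ∈ Finset.range d, m i = n := by
  induction d with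
  | zero =>
    intro k n h
    rw [powerSum_zero, coeff_one] at h
    refine ⟨fun _ => 0, ⟨fun i hi => by omega, fun i hi => by omega, fun i hi => by omega,
      fun i hi => by omega⟩, fun h => by omega, ?_⟩
    by_contra hne
    exact h (if_neg fun h => hne (by simp [h]))
  | succ d ih =>
    intro k n h
    rw [powerSum_succ] at h
    obtain ⟨j, hj, ha, hle, hS⟩ := exists_of_coeff_sum_ne_zero h
    obtain ⟨h1, h2⟩ := (recCoeff_ne_zero_iff hp hq hj.le).mp ha
    obtain ⟨m, hm, hlt, hsum⟩ := ih j (n - j) hS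
    exact ⟨seqCons j m, hm.cons h1 h2 hlt, fun _ => hj, by rw [sum_seqCons]; omega⟩

theorem exists_numChain_of_coeff_powerSumPrime_ne_zero {p f : ℕ} (hp : p.Prime)
    (hq : Fintype.card F = p ^ f) (d k n : ℕ)
    (h : (powerSumPrime F d k).coeff n ≠ 0) :
    ∃ m, NumChain p f k d m ∧ ∑ i ∈ Finset.range d, m i = n := by
  rcases d with _ | d
  · rw [powerSumPrime_zero, coeff_one] at h
    refine ⟨fun _ => 0, ⟨fun i hi => by omega, fun i hi => by omega, fun i hi => by omega,
      fun i hi => by omega⟩, ?_⟩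
    by_contra hne
    exact h (if_neg fun h => hne (by simp [h]))
  · rw [powerSumPrime_succ] at h
    obtain ⟨j, hj, ha, hle, hS⟩ := exists_of_coeff_sum_ne_zero h
    obtain ⟨h1, h2⟩ := (recCoeff_ne_zero_iff hp hq (by omega)).mp ha
    obtain ⟨m, hm, hlt, hsum⟩ := exists_numChain_of_coeff_powerSum_ne_zero hp hq d j (n - j) hS
    exact ⟨seqCons j m, hm.cons h1 h2 hlt, by rw [sum_seqCons]; omega⟩

/-- A monomial to which just one chain contributes does not vanish. -/
theorem coeff_powerSum_ne_zero {p f : ℕ} (hp : p.Prime)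
    (hq : Fintype.card F = p ^ f) (d : ℕ) : ∀ k m, NumChain p f k d m → (0 < d → m 0 < k) →
    (∀ m', NumChain p f k d m' → (0 < d → m' 0 < k) →
      ∑ i ∈ Finset.range d, m' i = ∑ i ∈ Finset.range d, m i → ∀ i < d, m' i = m i) →
    (powerSum F d k).coeff (∑ i ∈ Finset.range d, m i) ≠ 0 := by
  induction d with
  | zero => intro k m _ _ _; simp [powerSum_zero]
  | succ d ih =>
    intro k m hm hlt huniq
    have hs := Finset.sum_range_succ' m d
    have hmk := hlt (by omega)
    rw [powerSum_succ]
    refine coeff_sum_ne_zero (j₀ := m 0) hmk (by omega)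
      ((recCoeff_ne_zero_iff hp hq hmk.le).mpr ⟨hm.digitwise 0 (by omega), hm.modEq 0 (by omega)⟩)
      ?_ ?_
    · rw [hs, Nat.add_sub_cancel]
      refine ih (m 0) (fun i => m (i + 1)) hm.tail_head (fun hd => hm.lt 0 (by omega)) ?_
      intro m' hm' hlt' hsum i hi
      exact huniq (seqCons (m 0) m')
        (hm'.cons (hm.digitwise 0 (by omega)) (hm.modEq 0 (by omega)) hlt') (fun _ => hmk)
        (by rw [sum_seqCons]; omega) (i + 1) (by omega)
    · intro j hj ha hle hS
      obtain ⟨h1, h2⟩ := (recCoeff_ne_zero_iff hp hq hj.le).mp ha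
      obtain ⟨m', hm', hlt', hsum⟩ :=
        exists_numChain_of_coeff_powerSum_ne_zero hp hq d j _ hS
      exact huniq (seqCons j m') (hm'.cons h1 h2 hlt') (fun _ => hj)
        (by rw [sum_seqCons]; omega) 0 (by omega)

/-- The trailing term of the power sum comes from the chain with the least sum. -/
theorem coeff_powerSumPrime_ne_zero {p f : ℕ} [NeZero f] (hp : p.Prime)
    (hq : Fintype.card F = p ^ f) {d k : ℕ} {m : ℕ → ℕ}
    (hm : IsMinChain p f k d m) :
    (powerSumPrime F d k).coeff (∑ i ∈ Finset.range d, m i) ≠ 0 := by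
  have huniq : ∀ m', NumChain p f k d m' →
      ∑ i ∈ Finset.range d, m' i = ∑ i ∈ Finset.range d, m i → ∀ i < d, m' i = m i :=
    fun m' hm' hsum => IsMinChain.unique hp.two_le
      ⟨hm', fun x hx => by have := hm.2 x hx; omega⟩ hm
  rcases d with _ | d
  · simp [powerSumPrime_zero]
  · have hs := Finset.sum_range_succ' m d
    have hmk := (hm.1.digitwise 0 (by omega)).le hp.two_le
    rw [powerSumPrime_succ]
    refine coeff_sum_ne_zero (j₀ := m 0) (by omega) (by omega)
      ((recCoeff_ne_zero_iff hp hq hmk).mpr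
        ⟨hm.1.digitwise 0 (by omega), hm.1.modEq 0 (by omega)⟩) ?_ ?_
    · rw [hs, Nat.add_sub_cancel]
      refine coeff_powerSum_ne_zero hp hq d (m 0) (fun i => m (i + 1)) hm.1.tail_head
        (fun hd => hm.1.lt 0 (by omega)) ?_
      intro m' hm' hlt' hsum i hi
      exact huniq (seqCons (m 0) m')
        (hm'.cons (hm.1.digitwise 0 (by omega)) (hm.1.modEq 0 (by omega)) hlt')
        (by rw [sum_seqCons]; omega) (i + 1) (by omega)
    · intro j hj ha hle hS
      obtain ⟨h1, h2⟩ := (recCoeff_ne_zero_iff hp hq (by omega)).mp ha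
      obtain ⟨m', hm', hlt', hsum⟩ :=
        exists_numChain_of_coeff_powerSum_ne_zero hp hq d j _ hS
      exact huniq (seqCons j m') (hm'.cons h1 h2 hlt')
        (by rw [sum_seqCons]; omega) 0 (by omega)

end

/-! ### Trailing degrees of the power sums -/

section

variable {F : Type*} [Field F] [Fintype F] {p f : ℕ} [NeZero f]

theorem powerSumPrime_ne_zero_iff (hp : p.Prime) (hq : Fintype.card F = p ^ f) (d k : ℕ) :
    powerSumPrime F d k ≠ 0 ↔ ∃ m, NumChain p f k d m := by
  constructor
  · intro h
    obtain ⟨n, hn⟩ : ∃ n, (powerSumPrime F d k).coeff n ≠ 0 := by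
      by_contra! hcon
      exact h (Polynomial.ext (by simpa using hcon))
    obtain ⟨m, hm, -⟩ := exists_numChain_of_coeff_powerSumPrime_ne_zero hp hq d k n hn
    exact ⟨m, hm⟩
  · intro h h0
    obtain ⟨m, hm⟩ := exists_isMinChain h
    exact coeff_powerSumPrime_ne_zero hp hq hm (by rw [h0, coeff_zero])

theorem natTrailingDegree_powerSumPrime (hp : p.Prime) (hq : Fintype.card F = p ^ f) {d k : ℕ}
    {m : ℕ → ℕ} (hm : IsMinChain p f k d m) :
    (powerSumPrime F d k).natTrailingDegree = ∑ i ∈ Finset.range d, m i := by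
  have hne := coeff_powerSumPrime_ne_zero hp hq hm
  refine le_antisymm (natTrailingDegree_le_of_ne_zero hne) (le_natTrailingDegree ?_ ?_)
  · intro h0; exact hne (by rw [h0, coeff_zero])
  · intro n hn
    by_contra hcon
    obtain ⟨m', hm', hsum⟩ := exists_numChain_of_coeff_powerSumPrime_ne_zero hp hq d k n hcon
    have := hm.2 m' hm'
    omega

/-- A chain below `k` has at most `k + 1` members. -/
theorem powerSumPrime_eq_zero_of_lt (hp : p.Prime) (hq : Fintype.card F = p ^ f) {d k : ℕ}
    (h : k + 1 < d) : powerSumPrime F d k = 0 := by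
  by_contra hne
  obtain ⟨m, hm⟩ := (powerSumPrime_ne_zero_iff hp hq d k).mp hne
  have h1 : ∀ i < d, m i + i ≤ m 0 := by
    intro i
    induction i with
    | zero => intro _; omega
    | succ i ih => intro hi; have := ih (by omega); have := hm.lt i hi; omega
  have h2 := h1 (d - 1) (by omega)
  have h3 := (hm.digitwise 0 (by omega)).le hp.two_le
  omega

theorem trailing_succ (hp : p.Prime) (hq : Fintype.card F = p ^ f) {d k : ℕ}
    (h : powerSumPrime F (d + 1) k ≠ 0) : powerSumPrime F d k ≠ 0 ∧
      (powerSumPrime F d k).natTrailingDegree ≤ (powerSumPrime F (d + 1) k).natTrailingDegree ∧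
      (1 ≤ d ∨ ¬ p ^ f - 1 ∣ k → (powerSumPrime F d k).natTrailingDegree
        < (powerSumPrime F (d + 1) k).natTrailingDegree) := by
  obtain ⟨m, hm⟩ := exists_isMinChain ((powerSumPrime_ne_zero_iff hp hq _ _).mp h)
  have hex : ∃ n, NumChain p f k d n := ⟨_, hm.1.tail⟩
  obtain ⟨n, hn⟩ := exists_isMinChain hex
  have h1 := hn.2 _ hm.1.tail
  rw [natTrailingDegree_powerSumPrime hp hq hm, natTrailingDegree_powerSumPrime hp hq hn,
    Finset.sum_range_succ']
  refine ⟨(powerSumPrime_ne_zero_iff hp hq _ _).mpr hex, by omega, fun hd => ?_⟩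
  have : 0 < m 0 := by
    rcases hd with hd | hd
    · have := hm.1.lt 0 (by omega)
      omega
    · refine Nat.pos_of_ne_zero fun h0 => hd ?_
      have := hm.1.modEq 0 (by omega)
      rw [h0] at this
      exact (Nat.modEq_zero_iff_dvd).mp this.symm
  omega

/-- The trailing degree of the power sums increases with the degree `d`, strictly so from
`d = 1` on, and from `d = 0` on if `k` is not divisible by `p ^ f - 1`. -/
theorem trailing_lt (hp : p.Prime) (hq : Fintype.card F = p ^ f) {d d' k : ℕ} (hdd : d ≤ d')
    (h : powerSumPrime F d' k ≠ 0) : powerSumPrime F d k ≠ 0 ∧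
      (powerSumPrime F d k).natTrailingDegree ≤ (powerSumPrime F d' k).natTrailingDegree ∧
      (d < d' → 1 ≤ d ∨ ¬ p ^ f - 1 ∣ k → (powerSumPrime F d k).natTrailingDegree
        < (powerSumPrime F d' k).natTrailingDegree) := by
  induction d', hdd using Nat.le_induction with
  | base => exact ⟨h, le_rfl, fun h => absurd h (lt_irrefl _)⟩
  | succ d' hdd ih =>
    obtain ⟨h1, h2, h3⟩ := trailing_succ hp hq h
    obtain ⟨h4, h5, -⟩ := ih h1
    exact ⟨h4, h5.trans h2, fun _ hd => h5.trans_lt (h3 (hd.imp_left fun h => h.trans hdd))⟩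

/-! ### Vanishing of the sum of all power sums -/

theorem sum_powerSum_succ (D k : ℕ) : ∑ d ∈ Finset.range (D + 1), powerSum F d k
    = 1 + ∑ j ∈ Finset.range k,
      C (recCoeff F k j) * (X ^ j * ∑ d ∈ Finset.range D, powerSum F d j) := by
  rw [Finset.sum_range_succ', powerSum_zero, add_comm]
  congr 1
  rw [Finset.sum_congr rfl fun d _ => powerSum_succ d k, Finset.sum_comm]
  refine Finset.sum_congr rfl fun j _ => ?_
  rw [Finset.mul_sum, Finset.mul_sum]

theorem sum_powerSumPrime_succ (D k : ℕ) : ∑ d ∈ Finset.range (D + 1), powerSumPrime F d k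
    = 1 + ∑ j ∈ Finset.range (k + 1),
      C (recCoeff F k j) * (X ^ j * ∑ d ∈ Finset.range D, powerSum F d j) := by
  rw [Finset.sum_range_succ', powerSumPrime_zero, add_comm]
  congr 1
  rw [Finset.sum_congr rfl fun d _ => powerSumPrime_succ d k, Finset.sum_comm]
  refine Finset.sum_congr rfl fun j _ => ?_
  rw [Finset.mul_sum, Finset.mul_sum]

theorem recCoeff_zero_right {k : ℕ} (hk : Fintype.card F - 1 ∣ k) : recCoeff F k 0 = -1 := by
  simp [recCoeff, hk]

theorem dvd_of_recCoeff_ne_zero {k j : ℕ} (hk : Fintype.card F - 1 ∣ k) (hj : j ≤ k)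
    (h : recCoeff F k j ≠ 0) : Fintype.card F - 1 ∣ j := by
  rw [recCoeff] at h
  split_ifs at h with h1
  · exact (Nat.dvd_sub_iff_right hj hk).mp h1
  · exact absurd rfl h

theorem sum_powerSum_zero {D : ℕ} (hD : 0 < D) :
    ∑ d ∈ Finset.range D, powerSum F d 0 = 1 := by
  obtain ⟨D, rfl⟩ : ∃ D', D = D' + 1 := ⟨D - 1, by omega⟩
  rw [sum_powerSum_succ]; simp

/-- The trivial zeros of the Goss zeta function. -/
theorem sum_powerSum_eq_zero {k : ℕ} : ∀ {D : ℕ}, 0 < k → k < D → Fintype.card F - 1 ∣ k →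
    ∑ d ∈ Finset.range D, powerSum F d k = 0 := by
  induction k using Nat.strong_induction_on with
  | _ k ih =>
    intro D hk hD hdvd
    obtain ⟨D, rfl⟩ : ∃ D', D = D' + 1 := ⟨D - 1, by omega⟩
    rw [sum_powerSum_succ, Finset.sum_eq_single 0]
    · rw [recCoeff_zero_right hdvd, sum_powerSum_zero (by omega)]; simp
    · intro j hj hj0
      have hj := Finset.mem_range.mp hj
      by_cases hr : recCoeff F k j = 0
      · rw [hr, C_0, zero_mul]
      · rw [ih j hj (by omega) (by omega) (dvd_of_recCoeff_ne_zero hdvd hj.le hr), mul_zero,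
          mul_zero]
    · intro h; exact absurd (Finset.mem_range.mpr hk) h

/-- For `k` divisible by `q - 1` only the term `j = 0` of the recursion survives, and it is `-1`. -/
theorem sum_powerSumPrime_eq_zero {k D : ℕ} (hD : k < D) (hdvd : Fintype.card F - 1 ∣ k) :
    ∑ d ∈ Finset.range (D + 1), powerSumPrime F d k = 0 := by
  rw [sum_powerSumPrime_succ, Finset.sum_eq_single 0]
  · rw [recCoeff_zero_right hdvd, sum_powerSum_zero (by omega)]; simp
  · intro j hj hj0
    have hj := Finset.mem_range.mp hj
    by_cases hr : recCoeff F k j = 0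
    · rw [hr, C_0, zero_mul]
    · rw [sum_powerSum_eq_zero (by omega) (by omega)
        (dvd_of_recCoeff_ne_zero hdvd (by omega) hr), mul_zero, mul_zero]
  · intro h; exact absurd (Finset.mem_range.mpr (by omega)) h

end

/-! ### Valuations at a prime of degree one -/

section

variable {F : Type*} [Field F]

theorem isCoprime_X_sub_C_iff {a : F[X]} {θ : F} :
    IsCoprime a (X - C θ) ↔ (taylor θ a).coeff 0 ≠ 0 := by
  rw [isCoprime_comm, (irreducible_X_sub_C θ).coprime_iff_not_dvd, dvd_iff_isRoot,
    taylor_coeff_zero, IsRoot.def]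

theorem X_sub_C_pow_dvd_iff {θ : F} {P : F[X]} (hP : P ≠ 0) (n : ℕ) :
    (X - C θ) ^ n ∣ P ↔ n ≤ (taylor θ P).natTrailingDegree := by
  have hT : taylor θ P ≠ 0 := fun h => hP ((taylor_eq_zero θ P).mp h)
  have h1 : taylorEquiv θ ((X - C θ) ^ n) = X ^ n := by
    rw [map_pow]
    congr 1
    change taylor θ (X - C θ) = X
    rw [map_sub, taylor_X, taylor_C, add_sub_cancel_right]
  rw [← map_dvd_iff (taylorEquiv θ), h1, X_pow_dvd_iff]
  change (∀ d < n, (taylor θ P).coeff d = 0) ↔ _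
  constructor
  · exact fun h => le_natTrailingDegree hT h
  · exact fun h d hd => coeff_eq_zero_of_lt_natTrailingDegree (hd.trans_le h)

theorem ord_of_valued {θ : F} (hv : Irreducible (X - C θ)) {x : Kv (X - C θ) hv} {n : ℤ}
    (h : Valued.v x = WithZero.exp (-n)) :
    ord (X - C θ) hv x = (n : WithTop ℤ) := by
  have hx : x ≠ 0 := by
    rintro rfl
    rw [map_zero] at h
    exact WithZero.exp_ne_zero h.symm
  rw [ord, if_neg hx, h, WithZero.log_exp, neg_neg]

theorem natTrailingDegree_prod {ι : Type*} (s : Finset ι) (g : ι → F[X])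
    (hg : ∀ i ∈ s, g i ≠ 0) :
    (∏ i ∈ s, g i).natTrailingDegree = ∑ i ∈ s, (g i).natTrailingDegree := by
  classical
  induction s using Finset.induction_on with
  | empty => simp
  | insert a s ha ih =>
    rw [Finset.prod_insert ha, Finset.sum_insert ha, natTrailingDegree_mul
      (hg a (Finset.mem_insert_self _ _))
      (Finset.prod_ne_zero_iff.mpr fun i hi => hg i (Finset.mem_insert_of_mem hi)),
      ih fun i hi => hg i (Finset.mem_insert_of_mem hi)]

variable {θ : F} (hv : Irreducible (X - C θ))

/-- The embedding of `F[t]` in the completion of its fraction field at `X - θ`. -/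
noncomputable def embed : F[X] →+* Kv (X - C θ) hv :=
  (algebraMap (RatFunc F) (Kv (X - C θ) hv)).comp (algebraMap F[X] (RatFunc F))

theorem valued_embed {P : F[X]} (hP : P ≠ 0) :
    Valued.v (embed hv P) = WithZero.exp (-((taylor θ P).natTrailingDegree : ℤ)) := by
  have h1 : Valued.v (embed hv P) = (place (X - C θ) hv).intValuation P := by
    rw [← (place (X - C θ) hv).valuation_of_algebraMap (K := RatFunc F)]
    exact IsDedekindDomain.HeightOneSpectrum.valuedAdicCompletion_eq_valuation' _ _
  have h2 := (place (X - C θ) hv).intValuation_def (r := P)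
  rw [if_neg hP] at h2
  set c := (Associates.mk (place (X - C θ) hv).asIdeal).count
    (Associates.mk (Ideal.span {P})).factors
  have h3 : ∀ n : ℕ, n ≤ c ↔ n ≤ (taylor θ P).natTrailingDegree := by
    intro n
    rw [← X_sub_C_pow_dvd_iff hP, ← Ideal.mem_span_singleton, ← Ideal.span_singleton_pow]
    have h4 := (place (X - C θ) hv).intValuation_le_pow_iff_mem P n
    rw [h2, WithZero.exp_le_exp] at h4
    refine Iff.trans ?_ h4
    omega
  have h5 : c = (taylor θ P).natTrailingDegree :=
    le_antisymm ((h3 c).mp le_rfl) ((h3 _).mpr le_rfl)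
  rw [h1, h2, h5]

variable [Finite F]

open Classical in
/-- The power sum `∑ a ^ k` over the monic polynomials `a` of degree `d` prime to `v`. -/
noncomputable def powerSumCoprime (v : F[X]) (d k : ℕ) : F[X] :=
  ∑ a ∈ (monics F d).filter (fun a => IsCoprime a v), a ^ k

theorem Stilde_of_nonpos (v : F[X]) (d : ℕ) {s : ℤ} (hs : s ≤ 0) :
    Stilde v d s = algebraMap F[X] (RatFunc F) (powerSumCoprime v d (-s).toNat) := by
  rw [Stilde, powerSumCoprime, map_sum]
  refine Finset.sum_congr rfl fun a _ => ?_
  obtain ⟨k, rfl⟩ : ∃ k : ℕ, s = -k := ⟨(-s).toNat, by omega⟩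
  simp

theorem taylor_mem_monics {d : ℕ} {a : F[X]} (θ : F) (ha : a ∈ monics F d) :
    taylor θ a ∈ monics F d := by
  have := Fintype.ofFinite F
  rw [mem_monics] at ha ⊢
  exact ⟨by rw [Monic, leadingCoeff_taylor]; exact ha.1, by rw [natDegree_taylor]; exact ha.2⟩

/-- Translation by `θ` reduces the prime `X - θ` to the prime `X`. -/
theorem taylor_powerSumCoprime (θ : F) (d k : ℕ) :
    taylor θ (powerSumCoprime (X - C θ) d k) = powerSumPrime F d k := by
  classical
  rw [powerSumCoprime, powerSumPrime, map_sum]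
  refine Finset.sum_bij' (fun a _ => taylor θ a) (fun a _ => taylor (-θ) a) ?_ ?_ ?_ ?_ ?_
  · intro a ha
    rw [Finset.mem_filter] at ha ⊢
    exact ⟨taylor_mem_monics θ ha.1, isCoprime_X_sub_C_iff.mp ha.2⟩
  · intro a ha
    rw [Finset.mem_filter] at ha ⊢
    refine ⟨taylor_mem_monics _ ha.1, isCoprime_X_sub_C_iff.mpr ?_⟩
    rw [taylor_taylor, add_neg_cancel, taylor_zero]
    exact ha.2
  · intro a _
    rw [taylor_taylor, neg_add_cancel, taylor_zero]
  · intro a _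
    rw [taylor_taylor, add_neg_cancel, taylor_zero]
  · intro a _
    exact taylor_pow _ _ _

/-! ### The terms of the series -/

variable {r : ℕ} {s : Fin r → ℤ}

theorem zetaTerm_eq (hs : ∀ i, s i ≤ 0) (d : {d : Fin r → ℕ // StrictAnti d}) :
    zetaTerm (X - C θ) hv s d = embed hv (∏ i, powerSumCoprime (X - C θ) (d.1 i) (-s i).toNat) := by
  rw [zetaTerm, embed, RingHom.comp_apply, map_prod (algebraMap F[X] (RatFunc F))]
  congr 1
  exact Finset.prod_congr rfl fun i _ => Stilde_of_nonpos _ _ (hs i)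

theorem powerSumCoprime_eq_zero_iff (d k : ℕ) :
    powerSumCoprime (X - C θ) d k = 0 ↔ powerSumPrime F d k = 0 := by
  rw [← taylor_powerSumCoprime θ, taylor_eq_zero]

theorem nu_eq {d : ℕ} {s : ℤ} (hs : s ≤ 0) (h : powerSumPrime F d (-s).toNat ≠ 0) :
    nu (X - C θ) hv d s = ((powerSumPrime F d (-s).toNat).natTrailingDegree : ℤ) := by
  refine ord_of_valued hv ?_
  rw [Stilde_of_nonpos _ _ hs, ← taylor_powerSumCoprime θ]
  exact valued_embed hv fun h0 => h ((powerSumCoprime_eq_zero_iff d _).mp h0)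

theorem valued_zetaTerm (hs : ∀ i, s i ≤ 0) (d : {d : Fin r → ℕ // StrictAnti d})
    (h : ∀ i, powerSumPrime F (d.1 i) (-s i).toNat ≠ 0) :
    Valued.v (zetaTerm (X - C θ) hv s d) = WithZero.exp
      (-((∑ i, (powerSumPrime F (d.1 i) (-s i).toNat).natTrailingDegree : ℕ) : ℤ)) := by
  have hne : ∀ i, powerSumCoprime (X - C θ) (d.1 i) (-s i).toNat ≠ 0 := fun i h0 =>
    h i ((powerSumCoprime_eq_zero_iff _ _).mp h0)
  rw [zetaTerm_eq hv hs, valued_embed hv (Finset.prod_ne_zero_iff.mpr fun i _ => hne i)]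
  congr 3
  rw [show taylor θ (∏ i, powerSumCoprime (X - C θ) (d.1 i) (-s i).toNat)
      = ∏ i, taylor θ (powerSumCoprime (X - C θ) (d.1 i) (-s i).toNat) from
    map_prod (taylorAlgHom θ) _ _]
  simp only [taylor_powerSumCoprime]
  exact natTrailingDegree_prod _ _ fun i _ => h i

theorem zetaTerm_eq_zero (hs : ∀ i, s i ≤ 0) (d : {d : Fin r → ℕ // StrictAnti d}) (i : Fin r)
    (h : powerSumPrime F (d.1 i) (-s i).toNat = 0) : zetaTerm (X - C θ) hv s d = 0 := by
  rw [zetaTerm_eq hv hs, Finset.prod_eq_zero (Finset.mem_univ i)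
    ((powerSumCoprime_eq_zero_iff _ _).mpr h), map_zero]

theorem sub_le_of_strictAnti {d : Fin r → ℕ} (hd : StrictAnti d) (i : Fin r) :
    r - 1 - (i : ℕ) ≤ d i := by
  have h : ∀ n, ∀ i : Fin r, r - 1 - (i : ℕ) = n → n ≤ d i := by
    intro n
    induction n with
    | zero => intro i _; exact Nat.zero_le _
    | succ n ih =>
      intro i hi
      have hlt : (i : ℕ) + 1 < r := by omega
      have h1 := ih ⟨i + 1, hlt⟩ (by simp only; omega)
      have h2 := hd (show i < ⟨i + 1, hlt⟩ from Fin.lt_def.mpr (by simp))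
      omega
  exact h _ i rfl

end


section

variable {F : Type*} [Field F] [Finite F] {p f : ℕ} [NeZero f] {θ : F}
  (hv : Irreducible (X - C θ)) {r : ℕ} {s : Fin r → ℤ}

/-! ### The value of the series -/

theorem hasFiniteSupport_zetaTerm (hp : p.Prime) (hq : Nat.card F = p ^ f)
    (hs : ∀ i, s i ≤ 0) : (Function.support (zetaTerm (X - C θ) hv s)).Finite := by
  have := Fintype.ofFinite F
  rw [Nat.card_eq_fintype_card] at hq
  have hfin : ((fun d : {d : Fin r → ℕ // StrictAnti d} => d.1) ⁻¹'
      Set.Icc 0 fun i => (-s i).toNat + 1).Finite :=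
    (Set.finite_Icc _ _).preimage Subtype.val_injective.injOn
  refine hfin.subset fun d hd => ⟨fun i => Nat.zero_le _, fun i => ?_⟩
  by_contra hlt
  exact hd (zetaTerm_eq_zero hv hs d i
    (powerSumPrime_eq_zero_of_lt hp hq (by simp only at hlt; omega)))

/-- The index of the term of least valuation. -/
def leadingIndex (r : ℕ) : {d : Fin r → ℕ // StrictAnti d} :=
  ⟨fun i => r - 1 - i, fun i j h => by have := Fin.lt_def.mp h; simp only; omega⟩

/-- Every index other than the leading one exceeds it at a place where this costs valuation. -/
theorem exists_lt_of_ne_leadingIndex {d : {d : Fin r → ℕ // StrictAnti d}}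
    (hd : d ≠ leadingIndex r) :
    ∃ i : Fin r, r - 1 - (i : ℕ) < d.1 i ∧ (1 ≤ r - 1 - (i : ℕ) ∨ r = 1) := by
  obtain ⟨i, hi⟩ : ∃ i, d.1 i ≠ r - 1 - (i : ℕ) := by
    by_contra! hcon
    exact hd (Subtype.ext (funext hcon))
  have h1 := sub_le_of_strictAnti d.2 i
  by_cases h : 1 ≤ r - 1 - (i : ℕ) ∨ r = 1
  · exact ⟨i, by omega, h⟩
  · have hlt : (i : ℕ) - 1 < r := by omega
    have h2 := d.2 (show (⟨i - 1, hlt⟩ : Fin r) < i from Fin.lt_def.mpr (by simp only; omega))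
    exact ⟨⟨i - 1, hlt⟩, by simp only; omega, Or.inl (by simp only; omega)⟩

/-- The leading term dominates the series. -/
theorem valued_zeta (hp : p.Prime) (hq : Nat.card F = p ^ f) (hs : ∀ i, s i ≤ 0)
    (hne : ∀ i : Fin r, powerSumPrime F (r - 1 - (i : ℕ)) (-s i).toNat ≠ 0)
    (hodd : r = 1 → ∀ i : Fin r, ¬ p ^ f - 1 ∣ (-s i).toNat) :
    Valued.v (zeta (X - C θ) hv s) = WithZero.exp (-((∑ i : Fin r,
      (powerSumPrime F (r - 1 - (i : ℕ)) (-s i).toNat).natTrailingDegree : ℕ) : ℤ)) := by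
  classical
  have := Fintype.ofFinite F
  have hfin := hasFiniteSupport_zetaTerm hv hp hq hs
  rw [Nat.card_eq_fintype_card] at hq
  have hlead := valued_zetaTerm hv hs (leadingIndex r) hne
  have hmem : leadingIndex r ∈ hfin.toFinset := by
    rw [Set.Finite.mem_toFinset, Function.mem_support]
    intro h0
    rw [h0, map_zero] at hlead
    exact WithZero.exp_ne_zero hlead.symm
  rw [zeta, tsum_eq_sum (s := hfin.toFinset) (fun d hd => by simpa using hd),
    ← Finset.add_sum_erase _ _ hmem, Valuation.map_add_eq_of_lt_left, hlead]
  · rfl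
  rw [hlead]
  refine Valuation.map_sum_lt _ WithZero.exp_ne_zero fun d hd => ?_
  by_cases h0 : ∀ i, powerSumPrime F (d.1 i) (-s i).toNat ≠ 0
  · rw [valued_zetaTerm hv hs d h0, WithZero.exp_lt_exp, neg_lt_neg_iff, Nat.cast_lt]
    obtain ⟨i, hi, hi'⟩ := exists_lt_of_ne_leadingIndex (Finset.ne_of_mem_erase hd)
    refine Finset.sum_lt_sum
      (fun j _ => (trailing_lt hp hq (sub_le_of_strictAnti d.2 j) (h0 j)).2.1)
      ⟨i, Finset.mem_univ _, (trailing_lt hp hq hi.le (h0 i)).2.2 hi ?_⟩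
    exact hi'.imp_right fun hr => hodd hr i
  · push Not at h0
    obtain ⟨i, hi⟩ := h0
    rw [zetaTerm_eq_zero hv hs d i hi, map_zero]
    exact WithZero.exp_pos

/-- If the leading term contains a vanishing power sum, then so does every other term. -/
theorem zeta_eq_zero_of_powerSumPrime_eq_zero (hp : p.Prime) (hq : Nat.card F = p ^ f)
    (hs : ∀ i, s i ≤ 0) {i : Fin r}
    (hi : powerSumPrime F (r - 1 - (i : ℕ)) (-s i).toNat = 0) : zeta (X - C θ) hv s = 0 := by
  have := Fintype.ofFinite F
  rw [Nat.card_eq_fintype_card] at hq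
  have : ∀ d, zetaTerm (X - C θ) hv s d = 0 := by
    intro d
    refine zetaTerm_eq_zero hv hs d i ?_
    by_contra hne
    exact (trailing_lt hp hq (sub_le_of_strictAnti d.2 i) hne).1 hi
  rw [zeta, funext this, tsum_zero]

/-- Strictly decreasing sequences of length one are numbers. -/
def strictAntiFinOneEquiv : ℕ ≃ {d : Fin 1 → ℕ // StrictAnti d} where
  toFun n := ⟨fun _ => n, fun i j h => by have := Fin.lt_def.mp h; omega⟩
  invFun d := d.1 0
  left_inv _ := rfl
  right_inv d := Subtype.ext (funext fun i => by rw [Subsingleton.elim i 0])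

theorem zeta_eq_zero_of_dvd (hp : p.Prime) (hq : Nat.card F = p ^ f) {s : Fin 1 → ℤ}
    (hs : ∀ i, s i ≤ 0) (hdvd : p ^ f - 1 ∣ (-s 0).toNat) : zeta (X - C θ) hv s = 0 := by
  have := Fintype.ofFinite F
  rw [Nat.card_eq_fintype_card] at hq
  have h1 : ∀ n, zetaTerm (X - C θ) hv s (strictAntiFinOneEquiv n)
      = embed hv (powerSumCoprime (X - C θ) n (-s 0).toNat) := by
    intro n
    rw [zetaTerm_eq hv hs, Fin.prod_univ_one]
    rfl
  rw [zeta, ← strictAntiFinOneEquiv.tsum_eq, tsum_congr h1,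
    tsum_eq_sum (s := Finset.range ((-s 0).toNat + 1 + 1)), ← map_sum]
  · have h2 : ∑ n ∈ Finset.range ((-s 0).toNat + 1 + 1),
        powerSumCoprime (X - C θ) n (-s 0).toNat = 0 := by
      rw [← taylor_eq_zero θ, map_sum]
      simp only [taylor_powerSumCoprime]
      exact sum_powerSumPrime_eq_zero (by omega) (by rw [hq]; exact hdvd)
    rw [h2, map_zero]
  · intro n hn
    rw [Finset.mem_range] at hn
    rw [(powerSumCoprime_eq_zero_iff _ _).mpr
      (powerSumPrime_eq_zero_of_lt hp hq (by omega)), map_zero]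

theorem isTrivialZero_iff [Fintype F] (hp : p.Prime) (hq : Fintype.card F = p ^ f)
    (hs : ∀ i, s i ≤ 0) : IsTrivialZero p f s ↔
      ∃ i : Fin r, powerSumPrime F (r - 1 - (i : ℕ)) (-s i).toNat = 0 := by
  refine exists_congr fun i => ?_
  rw [← not_iff_not, ← ne_eq, powerSumPrime_ne_zero_iff hp hq]
  simp only [hs i, true_and, gt_iff_lt, not_lt]
  have hir := i.2
  obtain ⟨e, he⟩ : ∃ e, r - 1 - (i : ℕ) = e := ⟨_, rfl⟩
  have hr : (r : ℝ) - ((i : ℝ) + 1) = e := by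
    have : r = e + i + 1 := by omega
    have : (r : ℝ) = e + i + 1 := by exact_mod_cast this
    rw [this]; ring
  rw [he, hr]
  have hself : ∀ d ≤ 1, NumChain p f (-s i).toNat d fun _ => (-s i).toNat := fun d hd =>
    ⟨fun _ _ _ => le_rfl, fun _ _ => Nat.ModEq.refl _, fun _ _ => by omega, fun _ _ => by omega⟩
  rcases e with _ | d
  · have h0 := (le_L_iff (f := f) hp.two_le (-s i).toNat 0).mpr ⟨_, hself 1 le_rfl⟩
    refine iff_of_true ?_ ⟨_, hself 0 (by omega)⟩
    push_cast at h0 ⊢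
    linarith
  · rw [← le_L_iff hp.two_le]
    push_cast
    constructor <;> intro h <;> linarith

end

end VadicMZV

theorem mainTheorem2 {F : Type*} [Field F] [Finite F] (p f : ℕ) (hp : p.Prime)
    (hq : Nat.card F = p ^ f)
    (v : Polynomial F) (hmonic : v.Monic) (hv : Irreducible v) (hdeg : v.natDegree = 1)
    (r : ℕ) (hr : 0 < r) (s : Fin r → ℤ) (hs : ∀ i, s i ≤ 0) :
    Summable (VadicMZV.zetaTerm v hv s) ∧
    (VadicMZV.zeta v hv s = 0 ↔
      (1 < r ∧ VadicMZV.IsTrivialZero p f s) ∨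
      (r = 1 ∧ VadicMZV.QEven (p ^ f) (s ⟨0, hr⟩))) ∧
    (VadicMZV.zeta v hv s ≠ 0 →
      VadicMZV.ord v hv (VadicMZV.zeta v hv s) =
        ∑ i : Fin r, VadicMZV.nu v hv (r - 1 - (i : ℕ)) (s i)) := by
  have hf : NeZero f := ⟨by
    rintro rfl
    rw [pow_zero] at hq
    exact (Finite.one_lt_card (α := F)).ne' hq⟩
  obtain ⟨θ, rfl⟩ : ∃ θ, v = X - C θ := ⟨-v.coeff 0, by
    conv_lhs => rw [hmonic.eq_X_add_C hdeg]
    rw [C_neg, sub_neg_eq_add]⟩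
  have := Fintype.ofFinite F
  have hq' := hq
  rw [Nat.card_eq_fintype_card] at hq'
  have hsum : Summable (VadicMZV.zetaTerm (X - C θ) hv s) :=
    summable_of_hasFiniteSupport (VadicMZV.hasFiniteSupport_zetaTerm hv hp hq hs)
  have heven : ∀ i, VadicMZV.QEven (p ^ f) (s i) ↔ p ^ f - 1 ∣ (-s i).toNat := by
    intro i
    rw [VadicMZV.QEven, ← dvd_neg, ← Int.toNat_of_nonneg (neg_nonneg.mpr (hs i)),
      ← Int.natCast_dvd_natCast, VadicMZV.cast_pow_sub_one hp.two_le]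
    push_cast
    rfl
  by_cases hz : (1 < r ∧ VadicMZV.IsTrivialZero p f s) ∨
      (r = 1 ∧ VadicMZV.QEven (p ^ f) (s ⟨0, hr⟩))
  · have h0 : VadicMZV.zeta (X - C θ) hv s = 0 := by
      rcases hz with ⟨-, hz⟩ | ⟨rfl, hz⟩
      · obtain ⟨i, hi⟩ := (VadicMZV.isTrivialZero_iff hp hq' hs).mp hz
        exact VadicMZV.zeta_eq_zero_of_powerSumPrime_eq_zero hv hp hq hs hi
      · exact VadicMZV.zeta_eq_zero_of_dvd hv hp hq hs ((heven _).mp hz)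
    exact ⟨hsum, iff_of_true h0 hz, fun h => absurd h0 h⟩
  · have hne : ∀ i : Fin r, VadicMZV.powerSumPrime F (r - 1 - (i : ℕ)) (-s i).toNat ≠ 0 := by
      intro i hi
      rcases (show 1 ≤ r from hr).lt_or_eq with h1 | h1
      · exact hz (Or.inl ⟨h1, (VadicMZV.isTrivialZero_iff hp hq' hs).mpr ⟨i, hi⟩⟩)
      · rw [show r - 1 - (i : ℕ) = 0 by omega, VadicMZV.powerSumPrime_zero] at hi
        exact one_ne_zero hi
    have hval := VadicMZV.valued_zeta hv hp hq hs hne (fun h1 i hi => hz (Or.inr ⟨h1, by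
      have : i = ⟨0, hr⟩ := Fin.ext (by have := i.2; simp only; omega)
      rw [← this]
      exact (heven i).mpr hi⟩))
    refine ⟨hsum, iff_of_false (fun h0 => ?_) hz, fun _ => ?_⟩
    · rw [h0, map_zero] at hval
      exact WithZero.exp_ne_zero hval.symm
    · rw [VadicMZV.ord_of_valued hv hval, Finset.sum_congr rfl fun i _ =>
        VadicMZV.nu_eq hv (hs i) (hne i)]
      norm_cast
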